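/- All graphs are finite, simple and undirected. For a connected graph $G$ let $\varepsilon_G(u)=\max_{v}d_G(u,v)$ be the eccentricity of the vertex $u$, let the diameter be the maximum eccentricity, and let $\sigma_2(G)=\sum_{uv\in E(G)}\varepsilon_G(u)\varepsilon_G(v)$. For integers $j\ge -1$ put $\mu_j=n-1+\frac{j(j-1)}2+2j$, and for $j\ge 0$ put $\nu_j=\binom j2+j(n-j)$. **Theorem.** Let $G$ be a connected graph with $n$ vertices, $m$ edges, and diameter $d$. Then $n-1\le m\le \binom{n-d}2+(2n-d-2)$, and the following lower bounds hold. (a) If $d$ is odd and $2n-2-d\le m\le \binom{n-d}2+n-1$, then $$\sigma_2(G)\ge \frac{7d^3-d+6}{12}+(m-d)\frac{(d+1)^2}4 .$$ If $d$ is odd and $m=2n-2-d-k$ or $m=\binom{n-d}2+n-1+k$ with $1\le k\le n-d-1$, then $$\sigma_2(G)\ge \frac{7d^3-d+6}{12}+(m-d)\frac{(d+1)^2}4+\frac{k(d+1)}2 .$$ (b) If $d$ is even, $d\ge 4$, and $\mu_{k-1}<m\le\mu_k$ with an integer $k\ge 0$, then $$\sigma_2(G)\ge \frac{7d^3-4d}{12}+(m-d)\frac{d^2}4+(n-1-d+k)\frac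 d2 .$$ If moreover $d=4$ and $m=n\ge 7$, then this lower bound can be increased by $3$. (c) If $d=2$ and $\nu_k\le m<\nu_{k+1}$ with an integer $k\ge 0$, then $$\sigma_2(G)\ge \binom k2+2k(n-k)+4(m-\nu_k).$$ The bounds are sharp: for all integers $n,m,d$ with $2\le d\le n-1$ and $n-1\le m\le \binom{n-d}2+(2n-d-2)$, and also for $d=1$, $n\ge 2$, $m=\binom n2$ (the complete graphs are the only graphs of diameter $1$), and in each of the cases above, some connected graph with $n$ vertices, $m$ edges and diameter $d$ attains equality in the corresponding bound; when $d=4$ and $m=n\ge 7$, the bound increased by $3$ is the one that is attained. -/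

import Mathlib

/-- The eccentricity of a vertex as a natural number (the greatest distance from `u` to a vertex;
Mathlib's `eccent` takes values in `ℕ∞` and is finite in a finite connected graph). -/
noncomputable def ecc {V : Type*} (G : SimpleGraph V) (u : V) : ℕ :=
  (G.eccent u).toNat

open Classical in
/-- The second Zagreb eccentricity index: the sum of `ε(u) ε(v)` over the edges `uv`. -/
noncomputable def sigmaTwo {V : Type*} [Fintype V] (G : SimpleGraph V) : ℕ :=
  ∑ e ∈ G.edgeFinset,
    Sym2.lift ⟨fun u v => ecc G u * ecc G v, fun _ _ => Nat.mul_comm _ _⟩ e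

/-- `G` is a connected graph with `n` vertices, `m` edges and diameter `d`. -/
structure IsConnectedWith {V : Type*} [Fintype V] (G : SimpleGraph V) (n m d : ℕ) : Prop where
  connected : G.Connected
  card_verts : Fintype.card V = n
  card_edges : G.edgeSet.ncard = m
  diam_eq : G.diam = d

/-- The value `s` of the second Zagreb eccentricity index is attained by a connected graph with
`n` vertices, `m` edges and diameter `d`. -/
def SigmaTwoAttains (n m d : ℕ) (s : ℚ) : Prop :=
  ∃ G : SimpleGraph (Fin n), IsConnectedWith G n m d ∧ (sigmaTwo G : ℚ) = s

/-- `μ_j = n - 1 + C(j,2) + 2j`, with `C(j,2) = j(j-1)/2` also for `j = -1`. -/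
def muNum (n : ℕ) (j : ℤ) : ℤ := n - 1 + j * (j - 1) / 2 + 2 * j

/-- `ν_j = C(j,2) + j(n-j)`. -/
def nuNum (n j : ℕ) : ℤ := (j.choose 2 : ℤ) + j * ((n : ℤ) - j)

/-- The bound for odd diameter: `(7d³ - d + 6)/12 + (m - d)(d+1)²/4`. -/
def oddBound (m d : ℕ) : ℚ :=
  (7 * (d : ℚ) ^ 3 - d + 6) / 12 + ((m : ℚ) - d) * (((d : ℚ) + 1) ^ 2 / 4)

/-- The bound for even diameter at least four:
`(7d³ - 4d)/12 + (m - d) d²/4 + (n - 1 - d + k) d/2`. -/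
def evenBound (n m d k : ℕ) : ℚ :=
  (7 * (d : ℚ) ^ 3 - 4 * d) / 12 + ((m : ℚ) - d) * ((d : ℚ) ^ 2 / 4)
    + ((n : ℚ) - 1 - d + k) * ((d : ℚ) / 2)

/-- The bound for diameter two: `C(k,2) + 2k(n-k) + 4(m - ν_k)`. -/
def diamTwoBound (n m k : ℕ) : ℚ :=
  (k.choose 2 : ℚ) + 2 * k * ((n : ℚ) - k) + 4 * ((m : ℚ) - nuNum n k)

/-!
Fix a shortest path of length `d` between two vertices `a`, `b` at maximum distance and let
`r = ⌈d / 2⌉`. Every eccentricity is at least `r`, and the `i`-th vertex of the path has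
eccentricity at least `max i (d - i)`; so the path contributes at least `pathSum d`, each of the
`m - d` other edges at least `r ^ 2`, and each other edge with an end of eccentricity different
from `r` at least `r (r + 1)` (`IsDiametral.le_sigmaTwo`). It remains to count the edges of the
last kind.

With `w = n - 1 - d` vertices outside the path and `t` of them at distance `r` from both ends and of
eccentricity `r`, one can choose `w + t` distinct edges outside the path: every vertex is charged an
edge on the way to an end, namely to one closer than `r` if there is one, and the `t` central
vertices an edge on the way to either end
(`IsDiametral.exists_charged_edges`). At least `w - t` of these edges have a noncentral end, and all
of them do if `d` is even. On the other hand the edges between central vertices are few: they lie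
in a set of `w + 2` vertices for odd `d` (and one of the pairs is an edge of the path), and of
`t + 1` vertices for even `d`. These counts give (a) and (b). For `d = 4`, `m = n`
they also show that there are at most two central vertices, and that if there are two, some edge
outside the path has two noncentral ends; this yields the extra `3`. For `d = 2` the sum depends
only on the number of vertices adjacent to all others, and is decreasing in it.

For sharpness it suffices, given the lower bounds, to exhibit graphs with upper bounds on their
eccentricities. All extremal graphs with `d ≥ 3` consist of a path with middle vertex `r` and
further vertices joined to some of `r - 1`, `r`, `r + 1` and to each other
(`exists_path_with_attached`).
-/

section LowerBound
open Classical

variable {V : Type*} {G : SimpleGraph V}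

/-! ### Eccentricities and geodesics -/

/-- A sequence `v 0 = a, …, v d = b` tracing a shortest path between two vertices at distance `d`,
in a connected graph all of whose distances are at most `d`. Values of `v` beyond `d` are
irrelevant. -/
structure IsDiametral (G : SimpleGraph V) (d : ℕ) (a b : V) (v : ℕ → V) : Prop where
  connected : G.Connected
  adj : ∀ i < d, G.Adj (v i) (v (i + 1))
  dist_left : ∀ i ≤ d, G.dist (v i) a = i
  dist_right : ∀ i ≤ d, G.dist (v i) b = d - i
  dist_ends : G.dist a b = d
  dist_le : ∀ u w, G.dist u w ≤ d

theorem ediam_ne_top_of_connected [Finite V] (hG : G.Connected) : G.ediam ≠ ⊤ := by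
  have := hG.nonempty
  exact SimpleGraph.connected_iff_ediam_ne_top.1 hG

theorem dist_le_ecc [Finite V] (hG : G.Connected) (u w : V) : G.dist u w ≤ ecc G u := by
  have h1 : G.eccent u ≠ ⊤ := fun h =>
    ediam_ne_top_of_connected hG (top_le_iff.1 (h ▸ G.eccent_le_ediam (u := u)))
  exact ENat.toNat_le_toNat G.edist_le_eccent h1

theorem ecc_le [Finite V] (hG : G.Connected) {u : V} {k : ℕ} (h : ∀ w, G.dist u w ≤ k) :
    ecc G u ≤ k := by
  refine ENat.toNat_le_of_le_natCast ((G.eccent_le_iff u k).2 fun w => ?_)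
  rw [← (hG u w).coe_dist_eq_edist]
  exact_mod_cast h w

/-- The second vertex of a shortest walk from `w` to `x`. -/
theorem exists_adj_closer (hG : G.Connected) {w x : V} (h : w ≠ x) :
    ∃ y, G.Adj w y ∧ G.dist y x + 1 = G.dist w x := by
  obtain ⟨p, hp⟩ := hG.exists_walk_length_eq_dist w x
  cases p with
  | nil => exact absurd rfl h
  | @cons _ y _ hy q =>
    refine ⟨y, hy, ?_⟩
    have h1 := G.dist_le q
    have h2 := hG.dist_triangle (u := w) (v := y) (w := x)
    rw [SimpleGraph.dist_eq_one_iff_adj.2 hy] at h2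
    simp only [SimpleGraph.Walk.length_cons] at hp
    omega

theorem exists_isDiametral [Finite V] (hG : G.Connected) :
    ∃ a b v, IsDiametral G G.diam a b v := by
  have := hG.nonempty
  obtain ⟨a, b, hab⟩ := G.exists_dist_eq_diam
  have key : ∀ k, ∀ w, G.dist w b = k → ∃ v : ℕ → V, v 0 = w ∧ ∀ i ≤ k,
      (i < k → G.Adj (v i) (v (i + 1))) ∧ G.dist (v i) b = k - i := by
    intro k
    induction k with
    | zero => exact fun w hw => ⟨fun _ => w, rfl, fun i hi => ⟨fun h => by omega, by simpa using hw⟩⟩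
    | succ k ih =>
      intro w hw
      obtain ⟨y, hy, hyb⟩ := exists_adj_closer hG (w := w) (x := b)
        (by rintro rfl; simp at hw)
      obtain ⟨v, hv0, hv⟩ := ih y (by omega)
      refine ⟨fun i => if i = 0 then w else v (i - 1), rfl, fun i hi => ?_⟩
      rcases i with _ | i
      · simpa [hv0, hy] using hw
      · have := hv i (by omega)
        rcases i with _ | i
        · refine ⟨fun h => ?_, ?_⟩
          · simpa using this.1 (by omega)
          · simpa using this.2
        · refine ⟨fun h => ?_, ?_⟩
          · simpa using this.1 (by omega)
          · simpa using this.2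
  obtain ⟨v, hv0, hv⟩ := key _ a hab
  have hle := fun u w => G.dist_le_diam (ediam_ne_top_of_connected hG) (u := u) (v := w)
  have hup : ∀ i ≤ G.diam, G.dist (v i) a ≤ i := by
    intro i
    induction i with
    | zero => simp [hv0]
    | succ i ih =>
      intro hi
      have h1 := hG.dist_triangle (u := v (i + 1)) (v := v i) (w := a)
      rw [SimpleGraph.dist_eq_one_iff_adj.2 ((hv i (by omega)).1 (by omega)).symm] at h1
      have := ih (by omega)
      omega
  refine ⟨a, b, v, hG, fun i hi => (hv i hi.le).1 hi, fun i hi => ?_, fun i hi => (hv i hi).2,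
    hab, hle⟩
  have h1 := hup i hi
  have h2 := (hv i hi).2
  have h3 := hG.dist_triangle (u := a) (v := v i) (w := b)
  rw [G.dist_comm (u := a) (v := v i)] at h3
  omega

namespace IsDiametral
variable {d : ℕ} {a b : V} {v : ℕ → V}

theorem injOn (h : IsDiametral G d a b v) {i j : ℕ} (hi : i ≤ d) (hj : j ≤ d) (hij : v i = v j) :
    i = j := by
  rw [← h.dist_left i hi, hij, h.dist_left j hj]

theorem pathEdges_injOn (h : IsDiametral G d a b v) :
    Set.InjOn (fun i => s(v i, v (i + 1))) (Finset.range d : Set ℕ) := by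
  intro i hi j hj hij
  simp only [Finset.coe_range, Set.mem_Iio] at hi hj
  rcases Sym2.eq_iff.1 hij with ⟨h1, -⟩ | ⟨h1, h2⟩
  · exact h.injOn hi.le hj.le h1
  · have := h.injOn hi.le hj h1
    have := h.injOn (by omega) hj.le h2
    omega

theorem left_add_right (h : IsDiametral G d a b v) (w : V) : d ≤ G.dist w a + G.dist w b := by
  have := h.connected.dist_triangle (u := a) (v := w) (w := b)
  rw [h.dist_ends, G.dist_comm (u := a)] at this
  exact this

end IsDiametral

/-- The weight `ε(u) ε(v)` of an edge `uv`. -/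
noncomputable def edgeCost (G : SimpleGraph V) : Sym2 V → ℕ :=
  Sym2.lift ⟨fun u v => ecc G u * ecc G v, fun _ _ => Nat.mul_comm _ _⟩

theorem edgeCost_mk (u w : V) : edgeCost G s(u, w) = ecc G u * ecc G w := rfl

variable [Fintype V]

theorem sigmaTwo_eq : sigmaTwo G = ∑ e ∈ G.edgeFinset, edgeCost G e := rfl

/-- The vertices outside the diametral path `v 0, …, v d`. -/
noncomputable def offVerts (d : ℕ) (v : ℕ → V) : Finset V :=
  Finset.univ \ (Finset.range (d + 1)).image v

/-- The edges of the diametral path `v 0, …, v d`. -/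
noncomputable def pathEdges (d : ℕ) (v : ℕ → V) : Finset (Sym2 V) :=
  (Finset.range d).image fun i => s(v i, v (i + 1))

/-- The edges of `G` outside the diametral path `v 0, …, v d`. -/
noncomputable def offEdges (G : SimpleGraph V) (d : ℕ) (v : ℕ → V) : Finset (Sym2 V) :=
  G.edgeFinset \ pathEdges d v

theorem mem_offVerts {d : ℕ} {v : ℕ → V} {w : V} : w ∈ offVerts d v ↔ ∀ i ≤ d, v i ≠ w := by
  simp [offVerts]

/-- `e` has an end whose eccentricity is not `r`. -/
def HasNoncentralEnd (G : SimpleGraph V) (r : ℕ) (e : Sym2 V) : Prop := ∃ x ∈ e, ecc G x ≠ r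

/-- The contribution to `σ₂` guaranteed by a diametral path of length `d`. -/
def pathSum (d : ℕ) : ℕ := ∑ i ∈ Finset.range d, max i (d - i) * max (i + 1) (d - (i + 1))

namespace IsDiametral
variable {d : ℕ} {a b : V} {v : ℕ → V}

theorem le_ecc (h : IsDiametral G d a b v) {r : ℕ} (hr : 2 * r ≤ d + 1) (w : V) :
    r ≤ ecc G w := by
  have := h.left_add_right w
  have := dist_le_ecc h.connected w a
  have := dist_le_ecc h.connected w b
  omega

theorem ecc_path (h : IsDiametral G d a b v) {i : ℕ} (hi : i ≤ d) :
    max i (d - i) ≤ ecc G (v i) := by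
  have h1 := dist_le_ecc h.connected (v i) a
  have h2 := dist_le_ecc h.connected (v i) b
  rw [h.dist_left i hi] at h1
  rw [h.dist_right i hi] at h2
  omega

theorem card_offVerts (h : IsDiametral G d a b v) :
    (offVerts d v).card + d + 1 = Fintype.card V := by
  have h1 : ((Finset.range (d + 1)).image v).card = d + 1 := by
    rw [Finset.card_image_of_injOn, Finset.card_range]
    intro i hi j hj hij
    simp only [Finset.coe_range, Set.mem_Iio] at hi hj
    exact h.injOn (by omega) (by omega) hij
  have h2 := Finset.card_sdiff_add_card_eq_card (Finset.subset_univ ((Finset.range (d + 1)).image v))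
  rw [h1, Finset.card_univ] at h2
  rw [← h2]; rfl

theorem pathEdges_subset (h : IsDiametral G d a b v) : pathEdges d v ⊆ G.edgeFinset := by
  intro e he
  obtain ⟨i, hi, rfl⟩ := Finset.mem_image.1 he
  rw [SimpleGraph.mem_edgeFinset]
  exact h.adj i (Finset.mem_range.1 hi)

theorem card_offEdges (h : IsDiametral G d a b v) :
    (offEdges G d v).card + d = G.edgeFinset.card := by
  have h2 := Finset.card_sdiff_add_card_eq_card h.pathEdges_subset
  rw [pathEdges, Finset.card_image_of_injOn h.pathEdges_injOn, Finset.card_range] at h2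
  exact h2

theorem pathSum_add_sum_le (h : IsDiametral G d a b v) {c : Sym2 V → ℕ}
    (hc : ∀ e ∈ offEdges G d v, c e ≤ edgeCost G e) :
    pathSum d + ∑ e ∈ offEdges G d v, c e ≤ sigmaTwo G := by
  rw [sigmaTwo_eq, ← Finset.sum_sdiff h.pathEdges_subset, add_comm]
  refine add_le_add (Finset.sum_le_sum hc) ?_
  rw [pathEdges, Finset.sum_image h.pathEdges_injOn]
  refine Finset.sum_le_sum fun i hi => ?_
  have hi := Finset.mem_range.1 hi
  exact Nat.mul_le_mul (h.ecc_path hi.le) (h.ecc_path hi)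

/-- The diametral path contributes at least `pathSum d`, every other edge at least `r ^ 2`, and
an edge with an end of eccentricity greater than `r` at least `r (r + 1)`. -/
theorem le_sigmaTwo (h : IsDiametral G d a b v) {r : ℕ} (hr : 2 * r ≤ d + 1) :
    pathSum d + (offEdges G d v).card * r ^ 2 +
      r * ((offEdges G d v).filter (HasNoncentralEnd G r)).card ≤ sigmaTwo G := by
  refine le_trans (le_of_eq ?_) (h.pathSum_add_sum_le
    (c := fun e => r ^ 2 + r * if HasNoncentralEnd G r e then 1 else 0) fun e _ => ?_)
  · rw [Finset.card_filter, Finset.mul_sum, Finset.sum_add_distrib, Finset.sum_const, smul_eq_mul,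
      add_assoc]
  · induction e using Sym2.ind with
    | _ x y =>
      rw [edgeCost_mk]
      have hx := h.le_ecc hr x
      have hy := h.le_ecc hr y
      split_ifs with hb
      · obtain ⟨z, hz, hne⟩ := hb
        rcases Sym2.mem_iff.1 hz with rfl | rfl
        · have : r + 1 ≤ ecc G z := by omega
          nlinarith [Nat.mul_le_mul this hy]
        · have : r + 1 ≤ ecc G z := by omega
          nlinarith [Nat.mul_le_mul hx this]
      · nlinarith [Nat.mul_le_mul hx hy]

end IsDiametral
end LowerBound

section Charging
open Classical

variable {V : Type*} {G : SimpleGraph V}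

/-! ### Charging edges to the vertices outside the path -/


/-- A choice of a neighbour nearer to `x`, for every vertex other than `x`. -/
theorem exists_toward (hG : G.Connected) (x : V) :
    ∃ f : V → V, ∀ w, w ≠ x → G.Adj w (f w) ∧ G.dist (f w) x + 1 = G.dist w x := by
  have : ∀ w, ∃ y, w ≠ x → G.Adj w y ∧ G.dist y x + 1 = G.dist w x := fun w => by
    by_cases h : w = x
    · exact ⟨w, fun h' => absurd h h'⟩
    · obtain ⟨y, hy⟩ := exists_adj_closer hG h
      exact ⟨y, fun _ => hy⟩
  choose f hf using this
  exact ⟨f, hf⟩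

variable [Fintype V]

/-- The vertices outside the path which have distance `r` from both of its ends and
eccentricity `r`. -/
noncomputable def midVerts (G : SimpleGraph V) (d r : ℕ) (a b : V) (v : ℕ → V) : Finset V :=
  (offVerts d v).filter fun w => G.dist w a = r ∧ G.dist w b = r ∧ ecc G w = r

namespace IsDiametral
variable {d : ℕ} {a b : V} {v : ℕ → V}

theorem hasNoncentralEnd_of_mem (h : IsDiametral G d a b v) {r : ℕ} {e : Sym2 V} {x : V}
    (hx : x ∈ e) (hd : r < G.dist x a ∨ r < G.dist x b) : HasNoncentralEnd G r e := by
  refine ⟨x, hx, ?_⟩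
  have := dist_le_ecc h.connected x a
  have := dist_le_ecc h.connected x b
  omega

theorem mem_offEdges {x y : V} (hx : x ∈ offVerts d v)
    (hxy : G.Adj x y) : s(x, y) ∈ offEdges G d v := by
  refine Finset.mem_sdiff.2 ⟨SimpleGraph.mem_edgeFinset.2 hxy, fun he => ?_⟩
  obtain ⟨i, hi, hie⟩ := Finset.mem_image.1 he
  have hi := Finset.mem_range.1 hi
  rw [mem_offVerts] at hx
  rcases Sym2.eq_iff.1 hie with ⟨h1, -⟩ | ⟨-, h1⟩
  · exact hx i hi.le h1
  · exact hx _ hi h1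

/-- Each vertex outside the path is charged an edge leading towards `b` if it is closer than `r`
to `b`, and towards `a` otherwise; a vertex of `midVerts` is also charged an edge leading
towards `b`. The charged edges are distinct, since the charge of a vertex closer than `r` to one
end of the path leads to a vertex which is still closer to that end. -/
theorem exists_charged_edges (h : IsDiametral G d a b v) {r : ℕ} (hr1 : d ≤ 2 * r)
    (hr2 : 2 * r ≤ d + 1) :
    ∃ S T : Finset (Sym2 V), S ⊆ offEdges G d v ∧ T ⊆ S ∧
      S.card = (offVerts d v).card + (midVerts G d r a b v).card ∧
      T.card + (midVerts G d r a b v).card = (offVerts d v).card ∧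
      (∀ e ∈ T, HasNoncentralEnd G r e) ∧
      (2 * r = d → ∀ e ∈ S, HasNoncentralEnd G r e) := by
  obtain ⟨f, hf⟩ := exists_toward h.connected a
  obtain ⟨g, hg⟩ := exists_toward h.connected b
  set W := offVerts d v with hW
  set M := midVerts G d r a b v with hM
  have hva : v 0 = a := (h.connected.dist_eq_zero_iff).1 (h.dist_left 0 (Nat.zero_le _))
  have hvb : v d = b := (h.connected.dist_eq_zero_iff).1 (by rw [h.dist_right d le_rfl]; omega)
  have hWf : ∀ w ∈ W, G.Adj w (f w) ∧ G.dist (f w) a + 1 = G.dist w a := fun w hw =>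
    hf w fun hwa => mem_offVerts.1 hw 0 (Nat.zero_le _) (hva.trans hwa.symm)
  have hWg : ∀ w ∈ W, G.Adj w (g w) ∧ G.dist (g w) b + 1 = G.dist w b := fun w hw =>
    hg w fun hwb => mem_offVerts.1 hw d le_rfl (hvb.trans hwb.symm)
  have hMW : M ⊆ W := Finset.filter_subset _ _
  have hMd : ∀ w ∈ M, G.dist w a = r ∧ G.dist w b = r := fun w hw =>
    ⟨(Finset.mem_filter.1 hw).2.1, (Finset.mem_filter.1 hw).2.2.1⟩
  let p : V → V := fun w => if G.dist w b < r then g w else f w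
  have hp1 : ∀ w, G.dist w b < r → p w = g w := fun w hw => if_pos hw
  have hp2 : ∀ w, ¬ G.dist w b < r → p w = f w := fun w hw => if_neg hw
  have hpadj : ∀ w ∈ W, G.Adj w (p w) := fun w hw => by
    by_cases hwb : G.dist w b < r
    · rw [hp1 w hwb]; exact (hWg w hw).1
    · rw [hp2 w hwb]; exact (hWf w hw).1
  have hpinj : Set.InjOn (fun w => s(w, p w)) (W : Set V) := by
    intro w hw u hu hwu
    rcases Sym2.eq_iff.1 hwu with ⟨h1, -⟩ | ⟨h1, h2⟩
    · exact h1
    exfalso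
    have w1 := (hWf w hw).2
    have w2 := (hWg w hw).2
    have u1 := (hWf u hu).2
    have u2 := (hWg u hu).2
    by_cases hwb : G.dist w b < r <;> by_cases hub : G.dist u b < r
    · rw [hp1 w hwb] at h2; rw [hp1 u hub] at h1; rw [h2] at w2; rw [← h1] at u2; omega
    · rw [hp1 w hwb] at h2; rw [hp2 u hub] at h1; rw [h2] at w2; omega
    · rw [hp2 w hwb] at h2; rw [hp1 u hub] at h1; rw [← h1] at u2; omega
    · rw [hp2 w hwb] at h2; rw [hp2 u hub] at h1; rw [h2] at w1; rw [← h1] at u1; omega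
  have hginj : Set.InjOn (fun w => s(w, g w)) (M : Set V) := by
    intro w hw u hu hwu
    rcases Sym2.eq_iff.1 hwu with ⟨h1, -⟩ | ⟨h1, h2⟩
    · exact h1
    exfalso
    have w2 := (hWg w (hMW hw)).2
    have u2 := (hWg u (hMW hu)).2
    rw [h2] at w2; rw [← h1] at u2; omega
  have hdisj : Disjoint (W.image fun w => s(w, p w)) (M.image fun w => s(w, g w)) := by
    rw [Finset.disjoint_left]
    intro e he he'
    obtain ⟨w, hw, rfl⟩ := Finset.mem_image.1 he
    obtain ⟨u, hu, huw⟩ := Finset.mem_image.1 he'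
    have hud := hMd u hu
    have u1 := (hWf u (hMW hu)).2
    have u2 := (hWg u (hMW hu)).2
    have w2 := (hWg w hw).2
    rcases Sym2.eq_iff.1 huw with ⟨h1, h2⟩ | ⟨h1, h2⟩
    · subst h1
      rw [hp2 u (by omega)] at h2
      have := h.left_add_right (f u)
      rw [h2] at u2
      omega
    · rw [h2] at u2
      rw [hp1 w (by omega)] at h1
      rw [← h1] at w2
      omega
  have hTbad : ∀ w ∈ W, w ∉ M → HasNoncentralEnd G r s(w, p w) := by
    intro w hw hwM
    have l1 := h.left_add_right (f w)
    have l2 := h.left_add_right (g w)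
    have w1 := (hWf w hw).2
    have w2 := (hWg w hw).2
    by_cases hwb : G.dist w b < r
    · rw [hp1 w hwb]
      exact h.hasNoncentralEnd_of_mem (Sym2.mem_mk_right _ _) (Or.inl (by omega))
    rw [hp2 w hwb]
    by_cases hwa : G.dist w a < r
    · exact h.hasNoncentralEnd_of_mem (Sym2.mem_mk_right _ _) (Or.inr (by omega))
    refine ⟨w, Sym2.mem_mk_left _ _, fun he => hwM (Finset.mem_filter.2 ⟨hw, ?_⟩)⟩
    have := dist_le_ecc h.connected w a
    have := dist_le_ecc h.connected w b
    omega
  refine ⟨W.image (fun w => s(w, p w)) ∪ M.image fun w => s(w, g w),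
    (W \ M).image fun w => s(w, p w), ?_, ?_, ?_, ?_, ?_, ?_⟩
  · refine Finset.union_subset (fun e he => ?_) fun e he => ?_
    · obtain ⟨w, hw, rfl⟩ := Finset.mem_image.1 he
      exact mem_offEdges hw (hpadj w hw)
    · obtain ⟨w, hw, rfl⟩ := Finset.mem_image.1 he
      exact mem_offEdges (hMW hw) (hWg w (hMW hw)).1
  · exact (Finset.image_subset_image Finset.sdiff_subset).trans Finset.subset_union_left
  · rw [Finset.card_union_of_disjoint hdisj, Finset.card_image_of_injOn hpinj,
      Finset.card_image_of_injOn hginj]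
  · rw [Finset.card_image_of_injOn (hpinj.mono (by simp)),
      Finset.card_sdiff_add_card_eq_card hMW]
  · intro e he
    obtain ⟨w, hw, rfl⟩ := Finset.mem_image.1 he
    exact hTbad w (Finset.mem_sdiff.1 hw).1 (Finset.mem_sdiff.1 hw).2
  · intro hrd e he
    rcases Finset.mem_union.1 he with he | he
    · obtain ⟨w, hw, rfl⟩ := Finset.mem_image.1 he
      by_cases hwM : w ∈ M
      · have l1 := h.left_add_right (f w)
        have w1 := (hWf w hw).2
        have := hMd w hwM
        rw [hp2 w (by omega)]
        exact h.hasNoncentralEnd_of_mem (Sym2.mem_mk_right _ _) (Or.inr (by omega))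
      · exact hTbad w hw hwM
    · obtain ⟨w, hw, rfl⟩ := Finset.mem_image.1 he
      have l2 := h.left_add_right (g w)
      have w2 := (hWg w (hMW hw)).2
      have := hMd w hw
      exact h.hasNoncentralEnd_of_mem (Sym2.mem_mk_right _ _) (Or.inl (by omega))

/-! ### Counting the edges outside the path -/

/-- Two vertices of the path are adjacent only if they are consecutive, so every edge outside the
path has an end outside it. -/
theorem exists_mem_offVerts (h : IsDiametral G d a b v) {e : Sym2 V} (he : e ∈ offEdges G d v) :
    ∃ w ∈ offVerts d v, ∃ y, G.Adj w y ∧ e = s(w, y) := by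
  induction e using Sym2.ind with
  | _ x y =>
    obtain ⟨hxy, hne⟩ := Finset.mem_sdiff.1 he
    rw [SimpleGraph.mem_edgeFinset, SimpleGraph.mem_edgeSet] at hxy
    by_cases hx : x ∈ offVerts d v
    · exact ⟨x, hx, y, hxy, rfl⟩
    by_cases hy : y ∈ offVerts d v
    · exact ⟨y, hy, x, hxy.symm, Sym2.eq_swap⟩
    simp only [mem_offVerts, not_forall, not_not] at hx hy
    obtain ⟨i, hi, rfl⟩ := hx
    obtain ⟨j, hj, rfl⟩ := hy
    exfalso
    have h1 := h.connected.dist_triangle (u := v i) (v := v j) (w := a)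
    have h2 := h.connected.dist_triangle (u := v j) (v := v i) (w := a)
    rw [SimpleGraph.dist_eq_one_iff_adj.2 hxy, h.dist_left i hi, h.dist_left j hj] at h1
    rw [SimpleGraph.dist_eq_one_iff_adj.2 hxy.symm, h.dist_left i hi, h.dist_left j hj] at h2
    have hij : i ≠ j := by rintro rfl; exact G.loopless.irrefl _ hxy
    rcases (by omega : j = i + 1 ∨ i = j + 1) with rfl | rfl
    · exact hne (Finset.mem_image.2 ⟨i, Finset.mem_range.2 hj, rfl⟩)
    · exact hne (Finset.mem_image.2 ⟨j, Finset.mem_range.2 hi, Sym2.eq_swap⟩)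

/-- A vertex has at most three neighbours on the path. -/
theorem card_offEdges_le (h : IsDiametral G d a b v) :
    (offEdges G d v).card ≤ (offVerts d v).card.choose 2 + (offVerts d v).card * 3 := by
  have hsub : offEdges G d v ⊆ (offVerts d v).offDiag.image (fun p : V × V => s(p.1, p.2)) ∪
      (offVerts d v).biUnion fun w =>
        (Finset.Icc (G.dist w a - 1) (G.dist w a + 1)).image fun i => s(w, v i) := by
    intro e he
    obtain ⟨w, hw, y, hwy, rfl⟩ := h.exists_mem_offVerts he
    by_cases hy : y ∈ offVerts d v
    · exact Finset.mem_union_left _ (Finset.mem_image.2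
        ⟨(w, y), Finset.mem_offDiag.2 ⟨hw, hy, hwy.ne⟩, rfl⟩)
    · simp only [mem_offVerts, not_forall, not_not] at hy
      obtain ⟨i, hi, rfl⟩ := hy
      refine Finset.mem_union_right _ (Finset.mem_biUnion.2 ⟨w, hw, Finset.mem_image.2
        ⟨i, Finset.mem_Icc.2 ?_, rfl⟩⟩)
      have h1 := h.connected.dist_triangle (u := v i) (v := w) (w := a)
      have h2 := h.connected.dist_triangle (u := w) (v := v i) (w := a)
      rw [SimpleGraph.dist_eq_one_iff_adj.2 hwy.symm, h.dist_left i hi] at h1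
      rw [SimpleGraph.dist_eq_one_iff_adj.2 hwy, h.dist_left i hi] at h2
      omega
  refine (Finset.card_le_card hsub).trans ((Finset.card_union_le _ _).trans (add_le_add ?_ ?_))
  · exact (Sym2.card_image_offDiag _).le
  · refine Finset.card_biUnion_le_card_mul _ _ _ fun w _ => Finset.card_image_le.trans ?_
    rw [Nat.card_Icc]
    omega

/-- For `d = 2r - 1` only two vertices of the path can have eccentricity `r`. -/
theorem card_central_offEdges_lt (h : IsDiametral G d a b v) {r : ℕ} (hr : 2 * r = d + 1) :
    ((offEdges G d v).filter fun e => ¬ HasNoncentralEnd G r e).card + 1 ≤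
      ((offVerts d v).card + 2).choose 2 := by
  set C := offVerts d v ∪ {v (r - 1), v r} with hC
  have hc : C.card ≤ (offVerts d v).card + 2 :=
    (Finset.card_union_le _ _).trans (add_le_add_right Finset.card_le_two _)
  refine le_trans ?_ (Nat.choose_le_choose 2 hc)
  have hmid : s(v (r - 1), v r) ∈ pathEdges d v :=
    Finset.mem_image.2 ⟨r - 1, Finset.mem_range.2 (by omega), by
      rw [show r - 1 + 1 = r by omega]⟩
  have hcen : ∀ x, ecc G x = r → x ∈ C := by
    intro x hx
    by_cases hxW : x ∈ offVerts d v
    · exact Finset.mem_union_left _ hxW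
    simp only [mem_offVerts, not_forall, not_not] at hxW
    obtain ⟨i, hi, rfl⟩ := hxW
    have := h.ecc_path hi
    rcases (by omega : i = r - 1 ∨ i = r) with rfl | rfl <;> simp [hC]
  have hnot : s(v (r - 1), v r) ∉ (offEdges G d v).filter fun e => ¬ HasNoncentralEnd G r e :=
    fun he => (Finset.mem_sdiff.1 (Finset.mem_filter.1 he).1).2 hmid
  rw [← Finset.card_insert_of_notMem hnot, ← Sym2.card_image_offDiag]
  refine Finset.card_le_card fun e he => ?_
  rcases Finset.mem_insert.1 he with rfl | he
  · refine Finset.mem_image.2 ⟨(v (r - 1), v r), Finset.mem_offDiag.2 ⟨by simp [hC], by simp [hC],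
      fun hv => ?_⟩, rfl⟩
    have := h.injOn (by omega) (by omega) hv
    omega
  · obtain ⟨he, hb⟩ := Finset.mem_filter.1 he
    obtain ⟨w, -, y, hwy, rfl⟩ := h.exists_mem_offVerts he
    simp only [HasNoncentralEnd, Sym2.mem_iff, not_exists, not_and, not_not] at hb
    exact Finset.mem_image.2 ⟨(w, y), Finset.mem_offDiag.2
      ⟨hcen _ (hb w (Or.inl rfl)), hcen _ (hb y (Or.inr rfl)), hwy.ne⟩, rfl⟩

/-- For `d = 2r` only the middle vertex of the path can have eccentricity `r`. -/
theorem card_central_offEdges_le (h : IsDiametral G d a b v) {r : ℕ} (hr : 2 * r = d) :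
    ((offEdges G d v).filter fun e => ¬ HasNoncentralEnd G r e).card ≤
      ((midVerts G d r a b v).card + 1).choose 2 := by
  set C := midVerts G d r a b v ∪ {v r} with hC
  have hc : C.card ≤ (midVerts G d r a b v).card + 1 := Finset.card_union_le _ _
  refine le_trans ?_ (Nat.choose_le_choose 2 hc)
  have hcen : ∀ x, ecc G x = r → x ∈ C := by
    intro x hx
    have := h.left_add_right x
    have := dist_le_ecc h.connected x a
    have := dist_le_ecc h.connected x b
    by_cases hxW : x ∈ offVerts d v
    · exact Finset.mem_union_left _ (Finset.mem_filter.2 ⟨hxW, by omega, by omega, hx⟩)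
    simp only [mem_offVerts, not_forall, not_not] at hxW
    obtain ⟨i, hi, rfl⟩ := hxW
    have := h.ecc_path hi
    rcases (by omega : i = r) with rfl
    simp [hC]
  rw [← Sym2.card_image_offDiag]
  refine Finset.card_le_card fun e he => ?_
  obtain ⟨he, hb⟩ := Finset.mem_filter.1 he
  obtain ⟨w, -, y, hwy, rfl⟩ := h.exists_mem_offVerts he
  simp only [HasNoncentralEnd, Sym2.mem_iff, not_exists, not_and, not_not] at hb
  exact Finset.mem_image.2 ⟨(w, y), Finset.mem_offDiag.2
    ⟨hcen _ (hb w (Or.inl rfl)), hcen _ (hb y (Or.inr rfl)), hwy.ne⟩, rfl⟩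

theorem card_filter_offEdges (r : ℕ) :
    ((offEdges G d v).filter (HasNoncentralEnd G r)).card +
      ((offEdges G d v).filter fun e => ¬ HasNoncentralEnd G r e).card = (offEdges G d v).card :=
  Finset.card_filter_add_card_filter_not _

/-- The edges outside the path with an end of eccentricity greater than `r`, for `d = 2r - 1`. -/
theorem odd_card_noncentral (h : IsDiametral G d a b v) {r : ℕ} (hr : 2 * r = d + 1) :
    2 * (offVerts d v).card ≤ (offEdges G d v).card +
      ((offEdges G d v).filter (HasNoncentralEnd G r)).card ∧
    (offEdges G d v).card + 1 ≤ ((offVerts d v).card + 2).choose 2 +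
      ((offEdges G d v).filter (HasNoncentralEnd G r)).card := by
  obtain ⟨S, T, hS, hT, hSc, hTc, hTb, -⟩ := h.exists_charged_edges (by omega) hr.le
  have h1 := Finset.card_le_card hS
  have h2 : T ⊆ (offEdges G d v).filter (HasNoncentralEnd G r) := fun e he =>
    Finset.mem_filter.2 ⟨hS (hT he), hTb e he⟩
  have h2 := Finset.card_le_card h2
  have h3 := h.card_central_offEdges_lt hr
  have h4 := card_filter_offEdges (G := G) (d := d) (v := v) r
  omega

/-- The edges outside the path with an end of eccentricity greater than `r`, for `d = 2r`. -/
theorem even_card_noncentral (h : IsDiametral G d a b v) {r : ℕ} (hr : 2 * r = d) :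
    (offVerts d v).card + (midVerts G d r a b v).card ≤
      ((offEdges G d v).filter (HasNoncentralEnd G r)).card ∧
    (offEdges G d v).card ≤ ((midVerts G d r a b v).card + 1).choose 2 +
      ((offEdges G d v).filter (HasNoncentralEnd G r)).card := by
  obtain ⟨S, T, hS, -, hSc, -, -, hSb⟩ := h.exists_charged_edges hr.ge (by omega)
  have h2 : S ⊆ (offEdges G d v).filter (HasNoncentralEnd G r) := fun e he =>
    Finset.mem_filter.2 ⟨hS he, hSb hr e he⟩
  have h2 := Finset.card_le_card h2
  have h3 := h.card_central_offEdges_le hr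
  have h4 := card_filter_offEdges (G := G) (d := d) (v := v) r
  omega

end IsDiametral
end Charging

section
open Classical

variable {V : Type*} {G : SimpleGraph V} [Fintype V]

/-! ### Unicyclic graphs of diameter four -/

namespace IsDiametral
variable {a b : V} {v : ℕ → V}

/-- If a vertex `c` at distance two from both ends is the only vertex that can have eccentricity
two, then every edge not at `c` costs at least `9`, the two end edges of the path cost at least
`12`, and `c` has at most `n - 3` neighbours. -/
theorem le_sigmaTwo_of_central_unique (h : IsDiametral G 4 a b v) {c : V}
    (hca : G.dist c a = 2) (hcb : G.dist c b = 2) (hc : ∀ x, x ≠ c → 3 ≤ ecc G x) :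
    9 * G.edgeFinset.card + 15 ≤ sigmaTwo G + 3 * Fintype.card V := by
  have h0 : ecc G (v 0) ≥ 4 := h.ecc_path (Nat.zero_le 4)
  have h4 : ecc G (v 4) ≥ 4 := h.ecc_path (le_refl 4)
  have l0 := h.dist_left 0 (by omega)
  have l1 := h.dist_left 1 (by omega)
  have l3 := h.dist_left 3 (by omega)
  have l4 := h.dist_left 4 (by omega)
  have r3 := h.dist_right 3 (by omega)
  have r4 := h.dist_right 4 (by omega)
  have hva : v 0 = a := (h.connected.dist_eq_zero_iff).1 l0
  have hvb : v 4 = b := (h.connected.dist_eq_zero_iff).1 r4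
  have hne : ∀ i ≤ 4, i ≠ 2 → c ≠ v i := by
    rintro i hi hi2 rfl
    exact hi2 ((h.dist_left i hi).symm.trans hca)
  have hsum : ∀ e ∈ G.edgeFinset, 9 + (if e = s(v 0, v 1) then 3 else 0) +
      (if e = s(v 3, v 4) then 3 else 0) ≤ edgeCost G e + if c ∈ e then 3 else 0 := by
    intro e he
    have hdis : s(v 0, v 1) ≠ s(v 3, v 4) := by
      intro he
      rcases Sym2.eq_iff.1 he with ⟨h1, -⟩ | ⟨h1, -⟩
      · exact absurd (h.injOn (by omega) (by omega) h1) (by omega)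
      · exact absurd (h.injOn (by omega) (by omega) h1) (by omega)
    have c1 := hc _ (hne 1 (by omega) (by omega)).symm
    have c3 := hc _ (hne 3 (by omega) (by omega)).symm
    by_cases e1 : e = s(v 0, v 1)
    · rw [if_pos e1, if_neg (e1 ▸ hdis), e1, edgeCost_mk]
      split_ifs <;> nlinarith [Nat.mul_le_mul h0 c1]
    by_cases e2 : e = s(v 3, v 4)
    · rw [if_neg e1, if_pos e2, e2, edgeCost_mk]
      split_ifs <;> nlinarith [Nat.mul_le_mul c3 h4]
    rw [if_neg e1, if_neg e2]
    clear e1 e2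
    induction e using Sym2.ind with
    | _ x y =>
      rw [edgeCost_mk]
      rw [SimpleGraph.mem_edgeFinset, SimpleGraph.mem_edgeSet] at he
      have e2 : ∀ z, 2 ≤ ecc G z := h.le_ecc (by omega)
      by_cases hx : x = c
      · have hy := hc y (hx ▸ he.ne')
        rw [if_pos (by simp [hx])]
        nlinarith [Nat.mul_le_mul (e2 x) hy]
      · have hx := hc x hx
        by_cases hy : y = c
        · rw [if_pos (by simp [hy])]
          nlinarith [Nat.mul_le_mul hx (e2 y)]
        · split_ifs <;> nlinarith [Nat.mul_le_mul hx (hc y hy)]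
  have hsum := Finset.sum_le_sum hsum
  simp only [Finset.sum_add_distrib, Finset.sum_const, smul_eq_mul, Finset.sum_ite_eq',
    ← sigmaTwo_eq] at hsum
  rw [if_pos (SimpleGraph.mem_edgeFinset.2 (h.adj 0 (by omega))),
    if_pos (SimpleGraph.mem_edgeFinset.2 (h.adj 3 (by omega))), ← Finset.sum_filter,
    Finset.sum_const, smul_eq_mul] at hsum
  have hdeg : (G.edgeFinset.filter fun e => c ∈ e).card + 3 ≤ Fintype.card V := by
    have h1 : (G.edgeFinset.filter fun e => c ∈ e) ⊆
        (Finset.univ \ {v 0, v 4, c}).image fun y => s(c, y) := by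
      intro e he
      obtain ⟨he, hce⟩ := Finset.mem_filter.1 he
      obtain ⟨y, rfl⟩ := hce
      rw [SimpleGraph.mem_edgeFinset, SimpleGraph.mem_edgeSet] at he
      refine Finset.mem_image.2 ⟨y, ?_, rfl⟩
      have := SimpleGraph.dist_eq_one_iff_adj.2 he
      simp only [Finset.mem_sdiff, Finset.mem_univ, true_and, Finset.mem_insert,
        Finset.mem_singleton, not_or]
      refine ⟨?_, ?_, he.ne'⟩
      · rintro rfl; rw [hva] at this; omega
      · rintro rfl; rw [hvb] at this; omega
    have h2 : ({v 0, v 4, c} : Finset V).card = 3 := Finset.card_eq_three.2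
      ⟨_, _, _, fun h' => absurd (h.injOn (by omega) (by omega) h') (by omega),
        (hne 0 (by omega) (by omega)).symm, (hne 4 (by omega) (by omega)).symm, rfl⟩
    have h3 := Finset.card_sdiff_add_card_eq_card (Finset.subset_univ ({v 0, v 4, c} : Finset V))
    have h4 := (Finset.card_le_card h1).trans Finset.card_image_le
    rw [Finset.card_univ] at h3
    omega
  omega

/-- A unicyclic graph of diameter four has at most one vertex of eccentricity two outside the
path. If there is one and the middle of the path has eccentricity two as well, then some edge
outside the path joins two vertices of eccentricity at least three; otherwise all vertices outside
the path would be joined to both central vertices, which gives more than `n` edges. -/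
theorem le_sigmaTwo_of_unicyclic (h : IsDiametral G 4 a b v)
    (hm : G.edgeFinset.card = Fintype.card V) (hn : 7 ≤ Fintype.card V) :
    6 * Fintype.card V + 15 ≤ sigmaTwo G := by
  have hW := h.card_offVerts
  have hE := h.card_offEdges
  have l2 := h.dist_left 2 (by omega)
  have r2 := h.dist_right 2 (by omega)
  have hva : v 0 = a := (h.connected.dist_eq_zero_iff).1 (h.dist_left 0 (by omega))
  have hvb : v 4 = b := (h.connected.dist_eq_zero_iff).1 (h.dist_right 4 (by omega))
  obtain ⟨hb, -⟩ := h.even_card_noncentral (r := 2) rfl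
  have hbE := Finset.card_filter_le (offEdges G 4 v) (HasNoncentralEnd G 2)
  have hcen : ∀ x, x ≠ v 2 → x ∉ midVerts G 4 2 a b v → 3 ≤ ecc G x := by
    intro x hx hxM
    by_contra hlt
    have := h.left_add_right x
    have := dist_le_ecc h.connected x a
    have := dist_le_ecc h.connected x b
    by_cases hxW : x ∈ offVerts 4 v
    · exact hxM (Finset.mem_filter.2 ⟨hxW, by omega, by omega, by omega⟩)
    simp only [mem_offVerts, not_forall, not_not] at hxW
    obtain ⟨i, hi, rfl⟩ := hxW
    have := h.dist_left i hi
    have := h.dist_right i hi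
    rcases (by omega : i = 2) with rfl
    exact hx rfl
  rcases (by omega : (midVerts G 4 2 a b v).card = 0 ∨ (midVerts G 4 2 a b v).card = 1)
    with hM | hM
  · have := h.le_sigmaTwo_of_central_unique l2 r2
      fun x hx => hcen x hx (by rw [Finset.card_eq_zero.1 hM]; simp)
    omega
  obtain ⟨c, hc⟩ := Finset.card_eq_one.1 hM
  have hcM : c ∈ midVerts G 4 2 a b v := by rw [hc]; simp
  obtain ⟨hcW, hca, hcb, hce⟩ := Finset.mem_filter.1 hcM
  have hc2 : c ≠ v 2 := fun h' => mem_offVerts.1 hcW 2 (by omega) h'.symm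
  by_cases hv2 : 3 ≤ ecc G (v 2)
  · have := h.le_sigmaTwo_of_central_unique hca hcb fun x hx => by
      by_cases hx2 : x = v 2
      · rwa [hx2]
      · exact hcen x hx2 (by rw [hc]; simpa using hx)
    omega
  have hv2 : ecc G (v 2) = 2 := le_antisymm (by omega) (h.le_ecc (by omega) _)
  have hcen : ∀ x, x ≠ v 2 → x ≠ c → 3 ≤ ecc G x := fun x hx hxc =>
    hcen x hx (by rw [hc]; simpa using hxc)
  -- every edge outside the path has an end of eccentricity at least three
  have hbad : ∀ e ∈ offEdges G 4 v, HasNoncentralEnd G 2 e := by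
    have : (offEdges G 4 v).filter (HasNoncentralEnd G 2) = offEdges G 4 v :=
      Finset.eq_of_subset_of_card_le (Finset.filter_subset _ _) (by omega)
    intro e he
    rw [← this] at he
    exact (Finset.mem_filter.1 he).2
  by_cases hex : ∃ e ∈ offEdges G 4 v, 9 ≤ edgeCost G e
  · obtain ⟨e₀, he₀, hcost⟩ := hex
    have hs := h.pathSum_add_sum_le (c := fun e => 6 + if e = e₀ then 3 else 0) fun e he => by
      split_ifs with hee
      · rwa [hee]
      obtain ⟨x, hx, hxne⟩ := hbad e he
      obtain ⟨y, rfl⟩ := hx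
      rw [edgeCost_mk]
      have hx := h.le_ecc (r := 2) (by omega) x
      have hx : 3 ≤ ecc G x := by omega
      have hy := h.le_ecc (r := 2) (by omega) y
      nlinarith [Nat.mul_le_mul hx hy]
    rw [Finset.sum_add_distrib, Finset.sum_ite_eq', if_pos he₀, Finset.sum_const, smul_eq_mul,
      show pathSum 4 = 36 by decide] at hs
    omega
  exfalso
  have hno : ∀ x y, x ∈ offVerts 4 v → G.Adj x y → 3 ≤ ecc G x → ecc G y ≤ 2 := by
    intro x y hx hxy h3
    by_contra hy
    exact hex ⟨_, mem_offEdges hx hxy, by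
      rw [edgeCost_mk]; exact Nat.mul_le_mul h3 (by omega : 3 ≤ ecc G y)⟩
  have hc2n : ¬ G.Adj c (v 2) := by
    intro hadj
    obtain ⟨x, hx, hne⟩ := hbad _ (mem_offEdges hcW hadj)
    rcases Sym2.mem_iff.1 hx with rfl | rfl
    · exact hne hce
    · exact hne hv2
  have hc1 : G.Adj c (v 1) := by
    obtain ⟨y, hcy, hya⟩ := exists_adj_closer h.connected (w := c) (x := a)
      (by rintro rfl; simp at hca)
    have hya1 : G.dist y a = 1 := by omega
    have := h.left_add_right y
    have hyb := dist_le_ecc h.connected y b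
    by_cases hyW : y ∈ offVerts 4 v
    · have h1 := hno y a hyW (SimpleGraph.dist_eq_one_iff_adj.1 hya1) (by omega)
      have h2 := dist_le_ecc h.connected a b
      rw [h.dist_ends] at h2
      omega
    simp only [mem_offVerts, not_forall, not_not] at hyW
    obtain ⟨i, hi, rfl⟩ := hyW
    rw [h.dist_left i hi] at hya1
    exact hya1 ▸ hcy
  have hc3 : G.Adj c (v 3) := by
    obtain ⟨y, hcy, hyb⟩ := exists_adj_closer h.connected (w := c) (x := b)
      (by rintro rfl; simp at hcb)
    have hyb1 : G.dist y b = 1 := by omega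
    have := h.left_add_right y
    have hya := dist_le_ecc h.connected y a
    by_cases hyW : y ∈ offVerts 4 v
    · have h1 := hno y b hyW (SimpleGraph.dist_eq_one_iff_adj.1 hyb1) (by omega)
      have h2 := dist_le_ecc h.connected b a
      rw [G.dist_comm, h.dist_ends] at h2
      omega
    simp only [mem_offVerts, not_forall, not_not] at hyW
    obtain ⟨i, hi, rfl⟩ := hyW
    rw [h.dist_right i hi] at hyb1
    rcases (by omega : i = 3) with rfl
    exact hcy
  have hX : ∀ x ∈ (offVerts 4 v).erase c, G.Adj x c ∧ G.Adj x (v 2) := by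
    intro x hx
    obtain ⟨hxc, hxW⟩ := Finset.mem_erase.1 hx
    have hx2 : x ≠ v 2 := fun h' => mem_offVerts.1 hxW 2 (by omega) h'.symm
    have hnb : ∀ y, G.Adj x y → y = v 2 ∨ y = c := by
      intro y hxy
      by_contra! hy
      have := hno x y hxW hxy (hcen x hx2 hxc)
      have := hcen y hy.1 hy.2
      omega
    have d1 := dist_le_ecc h.connected c x
    have d2 := dist_le_ecc h.connected (v 2) x
    rw [G.dist_comm] at d1 d2
    constructor
    · obtain ⟨y, hxy, hy⟩ := exists_adj_closer h.connected hxc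
      rcases hnb y hxy with rfl | rfl
      · have := (h.connected).pos_dist_of_ne hc2.symm
        exact absurd (SimpleGraph.dist_eq_one_iff_adj.1 (by omega)).symm hc2n
      · exact hxy
    · obtain ⟨y, hxy, hy⟩ := exists_adj_closer h.connected hx2
      rcases hnb y hxy with rfl | rfl
      · exact hxy
      · have := (h.connected).pos_dist_of_ne hc2
        exact absurd (SimpleGraph.dist_eq_one_iff_adj.1 (by omega)) hc2n
  set X := (offVerts 4 v).erase c with hXdef
  have hXc : X.card + 1 = (offVerts 4 v).card := Finset.card_erase_add_one hcW
  have hvX : ∀ i ≤ 4, v i ∉ X := fun i hi h' =>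
    mem_offVerts.1 (Finset.mem_of_mem_erase h') i hi rfl
  have h13 : v 1 ∉ insert (v 3) X := by
    rw [Finset.mem_insert]
    rintro (h' | h')
    · exact absurd (h.injOn (by omega) (by omega) h') (by omega)
    · exact hvX 1 (by omega) h'
  have hinj : ∀ z : V, Function.Injective fun y => s(z, y) := fun z y y' h' =>
    Sym2.congr_right.1 h'
  have hdisj : Disjoint ((insert (v 1) (insert (v 3) X)).image fun y => s(c, y))
      (X.image fun y => s(v 2, y)) := by
    rw [Finset.disjoint_left]
    intro e he he'
    obtain ⟨y, -, rfl⟩ := Finset.mem_image.1 he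
    obtain ⟨x, hx, he⟩ := Finset.mem_image.1 he'
    rcases Sym2.eq_iff.1 he with ⟨h1, -⟩ | ⟨-, h1⟩
    · exact hc2 h1.symm
    · exact (Finset.mem_erase.1 hx).1 h1
  have hsub : ((insert (v 1) (insert (v 3) X)).image fun y => s(c, y)) ∪
      (X.image fun y => s(v 2, y)) ⊆ offEdges G 4 v := by
    refine Finset.union_subset (fun e he => ?_) fun e he => ?_
    · obtain ⟨y, hy, rfl⟩ := Finset.mem_image.1 he
      refine mem_offEdges hcW ?_
      rcases Finset.mem_insert.1 hy with rfl | hy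
      · exact hc1
      rcases Finset.mem_insert.1 hy with rfl | hy
      · exact hc3
      exact (hX y hy).1.symm
    · obtain ⟨y, hy, rfl⟩ := Finset.mem_image.1 he
      rw [Sym2.eq_swap]
      exact mem_offEdges (Finset.mem_of_mem_erase hy) (hX y hy).2
  have hcard := Finset.card_le_card hsub
  rw [Finset.card_union_of_disjoint hdisj, Finset.card_image_of_injective _ (hinj c),
    Finset.card_image_of_injective _ (hinj (v 2)), Finset.card_insert_of_notMem h13,
    Finset.card_insert_of_notMem (hvX 3 (by omega))] at hcard
  omega

/-! ### Diameter two -/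

/-- In a graph of diameter two with exactly `x` vertices joined to all others, the edges at these
vertices number `C(x, 2) + x (n - x)`; all other edges cost `4`. -/
theorem diam_two_count (h : IsDiametral G 2 a b v) :
    ∃ x ≤ Fintype.card V,
      x.choose 2 + x * (Fintype.card V - x) ≤ G.edgeFinset.card ∧
      4 * G.edgeFinset.card ≤ sigmaTwo G + 3 * x.choose 2 + 2 * (x * (Fintype.card V - x)) := by
  set U : Finset V := Finset.univ.filter fun u => ecc G u ≤ 1 with hU
  have hUadj : ∀ u ∈ U, ∀ y, u ≠ y → G.Adj u y := by
    intro u hu y huy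
    have h1 := dist_le_ecc h.connected u y
    have h2 := h.connected.pos_dist_of_ne huy
    have h3 := (Finset.mem_filter.1 hu).2
    exact SimpleGraph.dist_eq_one_iff_adj.1 (by omega)
  set A := U.offDiag.image fun p : V × V => s(p.1, p.2) with hA
  set B := (U ×ˢ Uᶜ).image fun p : V × V => s(p.1, p.2) with hB
  have hAc : A.card = U.card.choose 2 := Sym2.card_image_offDiag U
  have hBc : B.card = U.card * (Fintype.card V - U.card) := by
    rw [hB, Finset.card_image_of_injOn, Finset.card_product, Finset.card_compl]
    rintro ⟨x, y⟩ hxy ⟨x', y'⟩ hxy' he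
    simp only [Finset.coe_product, Set.mem_prod, Finset.mem_coe, Finset.mem_compl] at hxy hxy'
    rcases Sym2.eq_iff.1 he with ⟨h1, h2⟩ | ⟨h1, h2⟩
    · exact Prod.ext h1 h2
    · exact absurd ((show x = y' from h1) ▸ hxy.1) hxy'.2
  have hAE : A ⊆ G.edgeFinset := by
    intro e he
    obtain ⟨⟨x, y⟩, hxy, rfl⟩ := Finset.mem_image.1 he
    obtain ⟨hx, hy, hne⟩ := Finset.mem_offDiag.1 hxy
    exact SimpleGraph.mem_edgeFinset.2 (hUadj x hx y hne)
  have hBE : B ⊆ G.edgeFinset := by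
    intro e he
    obtain ⟨⟨x, y⟩, hxy, rfl⟩ := Finset.mem_image.1 he
    obtain ⟨hx, hy⟩ := Finset.mem_product.1 hxy
    exact SimpleGraph.mem_edgeFinset.2 (hUadj x hx y
      fun h' => Finset.mem_compl.1 hy (h' ▸ hx))
  have hAB : Disjoint A B := by
    rw [Finset.disjoint_left]
    intro e he he'
    obtain ⟨⟨x, y⟩, hxy, rfl⟩ := Finset.mem_image.1 he
    obtain ⟨⟨x', y'⟩, hxy', he⟩ := Finset.mem_image.1 he'
    obtain ⟨hx, hy, -⟩ := Finset.mem_offDiag.1 hxy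
    obtain ⟨-, hy'⟩ := Finset.mem_product.1 hxy'
    rcases Sym2.eq_iff.1 he with ⟨-, h1⟩ | ⟨-, h1⟩
    · exact Finset.mem_compl.1 hy' (h1 ▸ hy)
    · exact Finset.mem_compl.1 hy' (h1 ▸ hx)
  refine ⟨U.card, Finset.card_le_univ _, ?_, ?_⟩
  · rw [← hAc, ← hBc, ← Finset.card_union_of_disjoint hAB]
    exact Finset.card_le_card (Finset.union_subset hAE hBE)
  have hle : ∀ e ∈ G.edgeFinset, 4 ≤ edgeCost G e + (if e ∈ A then 3 else 0) +
      (if e ∈ B then 2 else 0) := by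
    intro e he
    induction e using Sym2.ind with
    | _ x y =>
      rw [SimpleGraph.mem_edgeFinset, SimpleGraph.mem_edgeSet] at he
      rw [edgeCost_mk]
      have e1 : ∀ z, 1 ≤ ecc G z := h.le_ecc (by omega)
      have e2 : ∀ z, z ∉ U → 2 ≤ ecc G z := fun z hz => by
        by_contra hlt
        exact hz (Finset.mem_filter.2 ⟨Finset.mem_univ _, by omega⟩)
      by_cases hx : x ∈ U <;> by_cases hy : y ∈ U
      · rw [if_pos (Finset.mem_image.2 ⟨(x, y), Finset.mem_offDiag.2 ⟨hx, hy, he.ne⟩, rfl⟩)]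
        split_ifs <;> nlinarith [Nat.mul_le_mul (e1 x) (e1 y)]
      · rw [if_pos (c := s(x, y) ∈ B) (Finset.mem_image.2 ⟨(x, y),
          Finset.mem_product.2 ⟨hx, Finset.mem_compl.2 hy⟩, rfl⟩)]
        split_ifs <;> nlinarith [Nat.mul_le_mul (e1 x) (e2 y hy)]
      · rw [if_pos (c := s(x, y) ∈ B) (Finset.mem_image.2 ⟨(y, x),
          Finset.mem_product.2 ⟨hy, Finset.mem_compl.2 hx⟩, Sym2.eq_swap⟩)]
        split_ifs <;> nlinarith [Nat.mul_le_mul (e2 x hx) (e1 y)]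
      · split_ifs <;> nlinarith [Nat.mul_le_mul (e2 x hx) (e2 y hy)]
  have hle := Finset.sum_le_sum hle
  simp only [Finset.sum_add_distrib, Finset.sum_const, smul_eq_mul, ← sigmaTwo_eq,
    ← Finset.sum_filter] at hle
  rw [Finset.filter_mem_eq_inter, Finset.filter_mem_eq_inter, Finset.inter_eq_right.2 hAE,
    Finset.inter_eq_right.2 hBE, hAc, hBc] at hle
  omega

end IsDiametral
end

/-! ### Closed forms and the lower bounds -/

/-- Both halves of the path contribute a sum of this form to `pathSum`. -/
theorem sum_range_consecutive_mul (r k : ℕ) :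
    3 * ∑ j ∈ Finset.range k, ((r : ℚ) + j) * (r + j + 1) = (r + k) ^ 3 - (r + k) - (r ^ 3 - r) := by
  induction k with
  | zero => simp
  | succ k ih => rw [Finset.sum_range_succ, mul_add, ih]; push_cast; ring

theorem pathSum_even (r : ℕ) :
    (pathSum (2 * r) : ℚ) = (7 * ((2 * r : ℕ) : ℚ) ^ 3 - 4 * ((2 * r : ℕ) : ℚ)) / 12 := by
  have h : pathSum (2 * r) = 2 * ∑ j ∈ Finset.range r, (r + j) * (r + j + 1) := by
    rw [pathSum, show Finset.range (2 * r) = Finset.range (r + r) by rw [two_mul],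
      Finset.sum_range_add, ← Finset.sum_range_reflect, two_mul (Finset.sum _ _)]
    congr 1 <;> refine Finset.sum_congr rfl fun j hj => ?_ <;> have hj := Finset.mem_range.1 hj
    · rw [show max (r - 1 - j) (2 * r - (r - 1 - j)) = r + j + 1 by omega,
        show max (r - 1 - j + 1) (2 * r - (r - 1 - j + 1)) = r + j by omega, mul_comm]
    · rw [show max (r + j) (2 * r - (r + j)) = r + j by omega,
        show max (r + j + 1) (2 * r - (r + j + 1)) = r + j + 1 by omega]
  have := sum_range_consecutive_mul r r
  rw [h]
  push_cast
  linear_combination (2 / 3 : ℚ) * this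

theorem pathSum_odd (s : ℕ) : (pathSum (2 * s + 1) : ℚ) =
    (7 * ((2 * s + 1 : ℕ) : ℚ) ^ 3 - ((2 * s + 1 : ℕ) : ℚ) + 6) / 12 := by
  have h : pathSum (2 * s + 1) =
      2 * ∑ j ∈ Finset.range s, (s + 1 + j) * (s + 1 + j + 1) + (s + 1) * (s + 1) := by
    rw [pathSum, show Finset.range (2 * s + 1) = Finset.range (s + (s + 1)) by congr 1; omega,
      Finset.sum_range_add, Finset.sum_range_succ', ← Finset.sum_range_reflect,
      two_mul (Finset.sum _ _), ← add_assoc]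
    congr 1
    · congr 1 <;> refine Finset.sum_congr rfl fun j hj => ?_ <;> have hj := Finset.mem_range.1 hj
      · rw [show max (s - 1 - j) (2 * s + 1 - (s - 1 - j)) = s + 1 + j + 1 by omega,
          show max (s - 1 - j + 1) (2 * s + 1 - (s - 1 - j + 1)) = s + 1 + j by omega, mul_comm]
      · rw [show max (s + (j + 1)) (2 * s + 1 - (s + (j + 1))) = s + 1 + j by omega,
          show max (s + (j + 1) + 1) (2 * s + 1 - (s + (j + 1) + 1)) = s + 1 + j + 1 by omega]
    · rw [show max (s + 0) (2 * s + 1 - (s + 0)) = s + 1 by omega,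
        show max (s + 0 + 1) (2 * s + 1 - (s + 0 + 1)) = s + 1 by omega]
  have := sum_range_consecutive_mul (s + 1) s
  rw [h]
  push_cast at this ⊢
  linear_combination (2 / 3 : ℚ) * this

theorem oddBound_eq (m s : ℕ) :
    oddBound m (2 * s + 1) = pathSum (2 * s + 1) + ((m : ℚ) - (2 * s + 1)) * ((s : ℚ) + 1) ^ 2 := by
  rw [pathSum_odd, oddBound]
  push_cast
  ring

theorem evenBound_eq (n m r k : ℕ) : evenBound n m (2 * r) k =
    pathSum (2 * r) + ((m : ℚ) - 2 * r) * (r : ℚ) ^ 2 + ((n : ℚ) - 1 - 2 * r + k) * r := by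
  rw [pathSum_even, evenBound]
  push_cast
  ring

theorem muNum_natCast (n j : ℕ) : muNum n j = n - 1 + (j.choose 2 : ℤ) + 2 * j := by
  have : (j : ℤ) * (j - 1) / 2 = (j.choose 2 : ℤ) := by
    rw [Nat.choose_two_right]
    rcases j with _ | j
    · simp
    · push_cast
      simp
  rw [muNum, this]

theorem muNum_zero_sub_one (n : ℕ) : muNum n (((0 : ℕ) : ℤ) - 1) = n - 2 := by
  norm_num [muNum]
  ring

theorem muNum_succ_sub_one (n j : ℕ) :
    muNum n (((j + 1 : ℕ) : ℤ) - 1) = n - 1 + (j.choose 2 : ℤ) + 2 * j := by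
  rw [← muNum_natCast]
  push_cast
  simp

theorem choose_succ_two (j : ℕ) : (j + 1).choose 2 = j + j.choose 2 := by
  rw [Nat.choose_succ_succ' j 1, Nat.choose_one_right]

section
variable {V : Type*} [Fintype V] {G : SimpleGraph V} {n m d : ℕ}

open Classical in
/-- The parameters of a connected graph in terms of a diametral path. -/
theorem IsConnectedWith.exists_isDiametral (hG : IsConnectedWith G n m d) :
    ∃ a b v, IsDiametral G d a b v ∧ (offVerts d v).card + d + 1 = n ∧
      (offEdges G d v).card + d = m ∧ G.edgeFinset.card = m := by
  obtain ⟨a, b, v, h⟩ := _root_.exists_isDiametral hG.connected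
  rw [hG.diam_eq] at h
  have hm : G.edgeFinset.card = m := by
    rw [← hG.card_edges, ← SimpleGraph.coe_edgeFinset, Set.ncard_coe_finset]
  exact ⟨a, b, v, h, h.card_offVerts.trans hG.card_verts, h.card_offEdges.trans hm, hm⟩

theorem IsConnectedWith.edges_range (hG : IsConnectedWith G n m d) :
    (n : ℤ) - 1 ≤ m ∧ (m : ℤ) ≤ ((n - d).choose 2 : ℤ) + (2 * n - d - 2) := by
  classical
  obtain ⟨a, b, v, h, hn, hm, -⟩ := hG.exists_isDiametral
  constructor
  · have := hG.connected.card_vert_le_card_edgeSet_add_one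
    rw [Nat.card_eq_fintype_card, hG.card_verts, Nat.card_coe_set_eq, hG.card_edges] at this
    omega
  · have h1 := h.card_offEdges_le
    have h2 := choose_succ_two (offVerts d v).card
    rw [show (offVerts d v).card + 1 = n - d by omega] at h2
    omega

/-- The bound for odd diameter; `k = 0` is the case without any condition on `m`. -/
theorem IsConnectedWith.oddBound_le (hG : IsConnectedWith G n m d) (hd : Odd d) {k : ℕ}
    (hk : k = 0 ∨
      ((m : ℤ) = 2 * n - 2 - d - k ∨ (m : ℤ) = ((n - d).choose 2 : ℤ) + n - 1 + k)) :
    oddBound m d + k * (((d : ℚ) + 1) / 2) ≤ sigmaTwo G := by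
  classical
  obtain ⟨a, b, v, h, hn, hm, -⟩ := hG.exists_isDiametral
  obtain ⟨s, rfl⟩ := hd
  have h1 := h.le_sigmaTwo (r := s + 1) (by omega)
  obtain ⟨h2, h3⟩ := h.odd_card_noncentral (r := s + 1) (by omega)
  have h4 := choose_succ_two ((offVerts (2 * s + 1) v).card + 1)
  rw [show (offVerts (2 * s + 1) v).card + 1 = n - (2 * s + 1) by omega,
    show n - (2 * s + 1) + 1 = (offVerts (2 * s + 1) v).card + 2 by omega] at h4
  generalize ((offEdges G (2 * s + 1) v).filter (HasNoncentralEnd G (s + 1))).card = β at *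
  have hkb : k ≤ β := by omega
  have h5 := Nat.mul_le_mul_left (s + 1) hkb
  have h6 : pathSum (2 * s + 1) + (offEdges G (2 * s + 1) v).card * (s + 1) ^ 2 + (s + 1) * k ≤
    sigmaTwo G := by omega
  have h6 : ((pathSum (2 * s + 1) + (offEdges G (2 * s + 1) v).card * (s + 1) ^ 2 +
    (s + 1) * k : ℕ) : ℚ) ≤ sigmaTwo G := by exact_mod_cast h6
  refine le_trans (le_of_eq ?_) h6
  rw [oddBound_eq, ← hm]
  push_cast
  ring

theorem IsConnectedWith.evenBound_le (hG : IsConnectedWith G n m d) (hd : Even d) {k : ℕ}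
    (hk : muNum n ((k : ℤ) - 1) < m) : evenBound n m d k ≤ sigmaTwo G := by
  classical
  obtain ⟨a, b, v, h, hn, hm, -⟩ := hG.exists_isDiametral
  obtain ⟨r, rfl⟩ := hd
  rw [← two_mul] at *
  have h1 := h.le_sigmaTwo (r := r) (by omega)
  obtain ⟨h2, h3⟩ := h.even_card_noncentral (r := r) rfl
  generalize ((offEdges G (2 * r) v).filter (HasNoncentralEnd G r)).card = β at *
  generalize (midVerts G (2 * r) r a b v).card = t at *
  have hkb : (offVerts (2 * r) v).card + k ≤ β := by
    by_cases ht : k ≤ t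
    · omega
    obtain ⟨j, rfl⟩ : ∃ j, k = j + 1 := ⟨k - 1, by omega⟩
    rw [muNum_succ_sub_one] at hk
    have h4 := Nat.choose_le_choose 2 (show t + 1 ≤ j + 1 by omega)
    rw [choose_succ_two j] at h4
    omega
  have h5 := Nat.mul_le_mul_left r hkb
  have h6 : pathSum (2 * r) + (offEdges G (2 * r) v).card * r ^ 2 +
    r * ((offVerts (2 * r) v).card + k) ≤ sigmaTwo G := by omega
  have h6 : ((pathSum (2 * r) + (offEdges G (2 * r) v).card * r ^ 2 +
    r * ((offVerts (2 * r) v).card + k) : ℕ) : ℚ) ≤ sigmaTwo G := by exact_mod_cast h6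
  refine le_trans (le_of_eq ?_) h6
  rw [evenBound_eq, ← hm, ← hn]
  push_cast
  ring

theorem evenBound_unicyclic {k : ℕ} (hk : muNum n ((k : ℤ) - 1) < n) (hk' : (n : ℤ) ≤ muNum n k) :
    k = 1 ∧ evenBound n n 4 k + 3 = 6 * n + 15 := by
  have hk1 : k = 1 := by
    rw [muNum_natCast] at hk'
    rcases k with _ | _ | k
    · simp at hk'
    · rfl
    · rw [muNum_succ_sub_one] at hk
      omega
  refine ⟨hk1, ?_⟩
  rw [hk1, evenBound]
  push_cast
  ring

theorem IsConnectedWith.unicyclic_le (hG : IsConnectedWith G n n 4) (hn : 7 ≤ n) :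
    (6 * n + 15 : ℚ) ≤ sigmaTwo G := by
  classical
  obtain ⟨a, b, v, h, -, -, hE⟩ := hG.exists_isDiametral
  have := h.le_sigmaTwo_of_unicyclic (hE.trans hG.card_verts.symm) (hG.card_verts.symm ▸ hn)
  rw [hG.card_verts] at this
  exact_mod_cast this

theorem nuNum_two_mul (n j : ℕ) : 2 * (nuNum n j : ℚ) = 2 * n * j - j * (j + 1) := by
  rw [nuNum]
  push_cast
  rw [Nat.cast_choose_two]
  ring

theorem IsConnectedWith.diamTwoBound_le (hG : IsConnectedWith G n m 2) {k : ℕ}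
    (hk : nuNum n k ≤ m) (hk' : (m : ℤ) < nuNum n (k + 1)) :
    diamTwoBound n m k ≤ sigmaTwo G := by
  classical
  obtain ⟨a, b, v, h, -, -, hE⟩ := hG.exists_isDiametral
  obtain ⟨x, hx, h1, h2⟩ := h.diam_two_count
  rw [hG.card_verts] at hx h1 h2
  rw [hE] at h1 h2
  have h1 : ((x.choose 2 + x * (n - x) : ℕ) : ℚ) ≤ m := by exact_mod_cast h1
  have h2 : ((4 * m : ℕ) : ℚ) ≤ (sigmaTwo G + 3 * x.choose 2 + 2 * (x * (n - x)) : ℕ) := by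
    exact_mod_cast h2
  have hk1 : (nuNum n k : ℚ) ≤ m := by exact_mod_cast hk
  have hk2 : (m : ℚ) < nuNum n (k + 1) := by exact_mod_cast hk'
  have e1 := nuNum_two_mul n k
  have e2 := nuNum_two_mul n (k + 1)
  push_cast [Nat.cast_sub hx, Nat.cast_choose_two] at h1 h2 e2
  have hkn : k + 2 ≤ n := by
    have : (k : ℚ) + 1 < n := by nlinarith
    have : k + 1 < n := by exact_mod_cast this
    omega
  have hkn' : (k : ℚ) + 2 ≤ n := by exact_mod_cast hkn
  have hxn : (x : ℚ) ≤ n := by exact_mod_cast hx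
  have hxk : x ≤ k := by
    by_contra hlt
    have : (k : ℚ) + 1 ≤ x := by exact_mod_cast not_le.1 hlt
    nlinarith [mul_nonneg (by linarith : (0 : ℚ) ≤ x - k - 1)
      (by linarith : (0 : ℚ) ≤ 2 * n - x - k - 2)]
  have hxk' : (x : ℚ) ≤ k := by exact_mod_cast hxk
  rw [diamTwoBound, Nat.cast_choose_two]
  nlinarith [mul_nonneg (by linarith : (0 : ℚ) ≤ k - x)
    (by linarith : (0 : ℚ) ≤ 4 * n - k - x - 3)]

end

/-! ### Graphs given by a list of edges -/

/-- The graph on `{0, …, n - 1}` whose edges are the pairs in `E`; it is used for sets `E` of pairs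
`(i, j)` with `i < j < n`. -/
def pairGraph (n : ℕ) (E : Finset (ℕ × ℕ)) : SimpleGraph (Fin n) :=
  SimpleGraph.fromRel fun u v => ((u : ℕ), (v : ℕ)) ∈ E

/-- The numbers `i` and `j` are vertices of `G` at distance at most `k`. -/
def Within {n : ℕ} (G : SimpleGraph (Fin n)) (k i j : ℕ) : Prop :=
  ∃ (hi : i < n) (hj : j < n), G.edist ⟨i, hi⟩ ⟨j, hj⟩ ≤ k

namespace Within
variable {n : ℕ} {G : SimpleGraph (Fin n)} {k l i j t : ℕ}

theorem refl (hi : i < n) : Within G k i i := ⟨hi, hi, by simp⟩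

theorem symm (h : Within G k i j) : Within G k j i := by
  obtain ⟨hi, hj, h⟩ := h
  exact ⟨hj, hi, by rwa [SimpleGraph.edist_comm]⟩

theorem trans (h : Within G k i j) (h' : Within G l j t) : Within G (k + l) i t := by
  obtain ⟨hi, hj, h⟩ := h
  obtain ⟨_, ht, h'⟩ := h'
  exact ⟨hi, ht, SimpleGraph.edist_triangle.trans (by push_cast; exact add_le_add h h')⟩

theorem mono (h : Within G k i j) (hkl : k ≤ l) : Within G l i j := by
  obtain ⟨hi, hj, h⟩ := h
  exact ⟨hi, hj, h.trans (by exact_mod_cast hkl)⟩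

theorem dist_le (h : Within G k i j) (hi : i < n) (hj : j < n) :
    G.dist ⟨i, hi⟩ ⟨j, hj⟩ ≤ k := by
  obtain ⟨_, _, h⟩ := h
  exact ENat.toNat_le_of_le_natCast h

end Within

section PairGraph
variable {n : ℕ} {E : Finset (ℕ × ℕ)}

theorem pairGraph_adj {u v : Fin n} : (pairGraph n E).Adj u v ↔
    u ≠ v ∧ (((u : ℕ), (v : ℕ)) ∈ E ∨ ((v : ℕ), (u : ℕ)) ∈ E) := SimpleGraph.fromRel_adj _ _ _

theorem within_one (hE : ∀ p ∈ E, p.1 < p.2 ∧ p.2 < n) {i j : ℕ} (h : (i, j) ∈ E) :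
    Within (pairGraph n E) 1 i j := by
  have := hE _ h
  refine ⟨this.1.trans this.2, this.2, ?_⟩
  rw [Nat.cast_one, SimpleGraph.edist_le_one_iff_adj_or_eq]
  exact Or.inl (pairGraph_adj.2 ⟨by simpa using this.1.ne, Or.inl h⟩)

open Classical in
theorem image_edgeFinset_pairGraph (hE : ∀ p ∈ E, p.1 < p.2 ∧ p.2 < n) :
    (pairGraph n E).edgeFinset.image (Sym2.map Fin.val) = E.image fun p => s(p.1, p.2) := by
  ext e
  simp only [Finset.mem_image, SimpleGraph.mem_edgeFinset]
  constructor
  · rintro ⟨e, he, rfl⟩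
    induction e using Sym2.ind with
    | _ u v =>
      rw [SimpleGraph.mem_edgeSet, pairGraph_adj] at he
      rcases he.2 with h | h
      · exact ⟨_, h, rfl⟩
      · exact ⟨_, h, Sym2.eq_swap⟩
  · rintro ⟨⟨i, j⟩, h, rfl⟩
    have := hE _ h
    refine ⟨s(⟨i, this.1.trans this.2⟩, ⟨j, this.2⟩), ?_, rfl⟩
    rw [SimpleGraph.mem_edgeSet, pairGraph_adj]
    exact ⟨by simpa using this.1.ne, Or.inl h⟩

theorem pair_injOn (hE : ∀ p ∈ E, p.1 < p.2) :
    Set.InjOn (fun p : ℕ × ℕ => s(p.1, p.2)) (E : Set (ℕ × ℕ)) := by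
  intro p hp p' hp' h
  have h1 := hE p hp
  have h2 := hE p' hp'
  rcases Sym2.eq_iff.1 h with ⟨h3, h4⟩ | ⟨h3, h4⟩
  · exact Prod.ext h3 h4
  · omega

/-- If all distances from a vertex `i` are at most `H i`, then `H` bounds the eccentricities, which
gives an upper bound for `σ₂`. A function `φ` that changes by at most one along every edge bounds
distances from below. -/
theorem pairGraph_isConnectedWith (hE : ∀ p ∈ E, p.1 < p.2 ∧ p.2 < n) {d : ℕ} {H φ : ℕ → ℕ}
    (hH : ∀ i < n, H i ≤ d) (hw : ∀ i < n, ∀ j < n, Within (pairGraph n E) (H i) i j)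
    (hφ : ∀ p ∈ E, φ p.1 ≤ φ p.2 + 1 ∧ φ p.2 ≤ φ p.1 + 1) {x y : ℕ} (hx : x < n) (hy : y < n)
    (hxy : φ x + d ≤ φ y) :
    IsConnectedWith (pairGraph n E) n E.card d ∧
      sigmaTwo (pairGraph n E) ≤ ∑ p ∈ E, H p.1 * H p.2 := by
  classical
  have hdist : ∀ u w : Fin n, (pairGraph n E).dist u w ≤ H u := fun u w =>
    (hw u u.2 w w.2).dist_le u.2 w.2
  have hreach : ∀ u w : Fin n, (pairGraph n E).Reachable u w := fun u w => by
    obtain ⟨_, _, h⟩ := hw u u.2 w w.2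
    exact SimpleGraph.reachable_of_edist_ne_top (ne_top_of_le_ne_top (ENat.natCast_ne_top _) h)
  have hconn : (pairGraph n E).Connected :=
    (SimpleGraph.connected_iff _).2 ⟨hreach, ⟨⟨x, hx⟩⟩⟩
  have hwalk : ∀ (u w : Fin n) (p : (pairGraph n E).Walk u w), φ w ≤ φ u + p.length := by
    intro u w p
    induction p with
    | nil => simp
    | cons h p ih =>
      rw [SimpleGraph.Walk.length_cons]
      rcases (pairGraph_adj.1 h).2 with h | h
      · have := (hφ _ h).2
        dsimp only at this
        omega
      · have := (hφ _ h).1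
        dsimp only at this
        omega
  have himg := image_edgeFinset_pairGraph hE
  have hinj := Sym2.map.injective (Fin.val_injective (n := n))
  have hinj' := pair_injOn fun p hp => (hE p hp).1
  refine ⟨⟨hconn, Fintype.card_fin n, ?_, le_antisymm ?_ ?_⟩, ?_⟩
  · rw [← SimpleGraph.coe_edgeFinset, Set.ncard_coe_finset,
      ← Finset.card_image_of_injective _ hinj, himg, Finset.card_image_of_injOn hinj']
  · obtain ⟨u, w, huw⟩ := @SimpleGraph.exists_dist_eq_diam _ (pairGraph n E) hconn.nonempty
    rw [← huw]
    exact (hdist u w).trans (hH u u.2)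
  · refine le_trans ?_ (SimpleGraph.dist_le_diam (ediam_ne_top_of_connected hconn)
      (u := ⟨x, hx⟩) (v := ⟨y, hy⟩))
    obtain ⟨p, hp⟩ := hconn.exists_walk_length_eq_dist ⟨x, hx⟩ ⟨y, hy⟩
    have := hwalk _ _ p
    dsimp only at this
    omega
  · let c : Sym2 ℕ → ℕ := Sym2.lift ⟨fun i j => H i * H j, fun _ _ => Nat.mul_comm _ _⟩
    calc sigmaTwo (pairGraph n E)
        ≤ ∑ e ∈ (pairGraph n E).edgeFinset, c (Sym2.map Fin.val e) := by
          rw [sigmaTwo_eq]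
          refine Finset.sum_le_sum fun e _ => ?_
          induction e using Sym2.ind with
          | _ u w => exact Nat.mul_le_mul (ecc_le hconn (hdist u)) (ecc_le hconn (hdist w))
      _ = ∑ p ∈ E, H p.1 * H p.2 := by
          rw [← Finset.sum_image (g := Sym2.map Fin.val) (f := c) hinj.injOn, himg,
            Finset.sum_image hinj']
          rfl

end PairGraph

/-- The pairs `(i, j)` of elements of `S` with `i < j`. -/
def increasingPairs (S : Finset ℕ) : Finset (ℕ × ℕ) := (S ×ˢ S).filter fun p => p.1 < p.2

theorem mem_increasingPairs {S : Finset ℕ} {p : ℕ × ℕ} :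
    p ∈ increasingPairs S ↔ p.1 ∈ S ∧ p.2 ∈ S ∧ p.1 < p.2 := by
  simp [increasingPairs, and_assoc]

theorem card_increasingPairs (S : Finset ℕ) : (increasingPairs S).card = S.card.choose 2 := by
  rw [← Sym2.card_image_offDiag, ← Finset.card_image_of_injOn
    (pair_injOn (E := increasingPairs S) fun p hp => (mem_increasingPairs.1 hp).2.2)]
  congr 1
  ext e
  simp only [Finset.mem_image, mem_increasingPairs, Finset.mem_offDiag]
  constructor
  · rintro ⟨p, ⟨h1, h2, h3⟩, rfl⟩
    exact ⟨p, ⟨h1, h2, h3.ne⟩, rfl⟩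
  · rintro ⟨p, ⟨h1, h2, h3⟩, rfl⟩
    rcases Nat.lt_or_gt_of_ne h3 with h | h
    · exact ⟨p, ⟨h1, h2, h⟩, rfl⟩
    · exact ⟨(p.2, p.1), ⟨h2, h1, h⟩, Sym2.eq_swap⟩

/-! ### Extremal graphs of diameter one and two -/

theorem sigmaTwoAttains_complete {n : ℕ} (hn : 2 ≤ n) :
    SigmaTwoAttains n (n.choose 2) 1 (oddBound (n.choose 2) 1) := by
  have : Nontrivial (Fin n) := Fin.nontrivial_iff_two_le.2 hn
  classical
  have h := SimpleGraph.card_edgeFinset_top_eq_card_choose_two (V := Fin n)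
  rw [Fintype.card_fin] at h
  refine ⟨⊤, ⟨SimpleGraph.connected_top, Fintype.card_fin n, ?_, SimpleGraph.diam_top⟩, ?_⟩
  · rw [← SimpleGraph.coe_edgeFinset, Set.ncard_coe_finset]
    convert h
  · have h1 : ∀ u, ecc (⊤ : SimpleGraph (Fin n)) u = 1 := fun u => by
      rw [ecc, SimpleGraph.eccent_top]; rfl
    have h2 : ∀ e, edgeCost (⊤ : SimpleGraph (Fin n)) e = 1 := fun e => by
      induction e using Sym2.ind with
      | _ x y => rw [edgeCost_mk, h1, h1]
    have h3 : sigmaTwo (⊤ : SimpleGraph (Fin n)) = n.choose 2 := by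
      rw [sigmaTwo_eq, Finset.sum_congr rfl fun e _ => h2 e, Finset.sum_const, smul_eq_mul, mul_one]
      convert h
    rw [h3, oddBound]
    norm_num

/-- `k` vertices are joined to all others, and vertex `k` to `e` further ones. -/
theorem exists_diam_two {n k e : ℕ} (hk : 1 ≤ k) (he : k + e + 2 ≤ n) :
    ∃ G : SimpleGraph (Fin n), IsConnectedWith G n (k.choose 2 + k * (n - k) + e) 2 ∧
      sigmaTwo G ≤ k.choose 2 + 2 * (k * (n - k)) + 4 * e := by
  set A := increasingPairs (Finset.range k) with hA
  set B := Finset.range k ×ˢ Finset.Ico k n with hB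
  set C := ({k} : Finset ℕ) ×ˢ Finset.Ico (k + 1) (k + 1 + e) with hC
  have memA : ∀ p, p ∈ A ↔ p.1 < k ∧ p.2 < k ∧ p.1 < p.2 := fun p => by
    simp [hA, mem_increasingPairs]
  have memB : ∀ p, p ∈ B ↔ p.1 < k ∧ k ≤ p.2 ∧ p.2 < n := fun p => by simp [hB]
  have memC : ∀ p, p ∈ C ↔ p.1 = k ∧ k + 1 ≤ p.2 ∧ p.2 < k + 1 + e := fun p => by
    rw [hC, Finset.mem_product, Finset.mem_singleton, Finset.mem_Ico]
  have hAB : Disjoint A B := Finset.disjoint_left.2 fun p hp hp' => by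
    rw [memA] at hp; rw [memB] at hp'; omega
  have hABC : Disjoint (A ∪ B) C := Finset.disjoint_left.2 fun p hp hp' => by
    rw [Finset.mem_union, memA, memB] at hp; rw [memC] at hp'; omega
  have mem : ∀ p, p ∈ (A ∪ B) ∪ C ↔ (p.1 < k ∧ p.2 < k ∧ p.1 < p.2 ∨
      p.1 < k ∧ k ≤ p.2 ∧ p.2 < n) ∨ p.1 = k ∧ k + 1 ≤ p.2 ∧ p.2 < k + 1 + e := fun p => by
    rw [Finset.mem_union, Finset.mem_union, memA, memB, memC]
  have hE : ∀ p ∈ (A ∪ B) ∪ C, p.1 < p.2 ∧ p.2 < n := fun p hp => by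
    rw [mem] at hp; omega
  have hadj : ∀ i j, i < k → j < n → Within (pairGraph n ((A ∪ B) ∪ C)) 1 i j := by
    intro i j hi hj
    rcases lt_trichotomy i j with h | rfl | h
    · exact within_one hE ((mem _).2 (by dsimp only; omega))
    · exact Within.refl hj
    · exact (within_one hE ((mem (j, i)).2 (by dsimp only; omega))).symm
  have key := pairGraph_isConnectedWith hE (d := 2) (H := fun i => if i < k then 1 else 2)
    (φ := fun i => if i = k then 0 else if i = n - 1 then 2 else 1)
    (fun i _ => by split_ifs <;> omega)
    (fun i hi j hj => by
      split_ifs with h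
      · exact hadj i j h hj
      · exact (hadj 0 i hk hi).symm.trans (hadj 0 j hk hj))
    (fun p hp => by
      rw [mem] at hp
      split_ifs <;> omega)
    (x := k) (y := n - 1) (by omega) (by omega)
    (by rw [if_pos rfl, if_neg (by omega), if_pos rfl])
  rw [Finset.card_union_of_disjoint hABC, Finset.card_union_of_disjoint hAB,
    Finset.sum_union hABC, Finset.sum_union hAB] at key
  have cA : A.card = k.choose 2 := by rw [hA, card_increasingPairs, Finset.card_range]
  have cB : B.card = k * (n - k) := by
    rw [hB, Finset.card_product, Finset.card_range, Nat.card_Ico]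
  have cC : C.card = e := by
    rw [hC, Finset.card_product, Finset.card_singleton, Nat.card_Ico]; omega
  rw [cA, cB, cC] at key
  refine ⟨_, key.1, key.2.trans (le_of_eq ?_)⟩
  have sA := Finset.sum_congr (s₁ := A) rfl fun p hp => show
      (if p.1 < k then 1 else 2) * (if p.2 < k then 1 else 2) = 1 by
    rw [memA] at hp; rw [if_pos hp.1, if_pos hp.2.1]
  have sB := Finset.sum_congr (s₁ := B) rfl fun p hp => show
      (if p.1 < k then 1 else 2) * (if p.2 < k then 1 else 2) = 2 by
    rw [memB] at hp; rw [if_pos hp.1, if_neg (not_lt.2 hp.2.1)]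
  have sC := Finset.sum_congr (s₁ := C) rfl fun p hp => show
      (if p.1 < k then 1 else 2) * (if p.2 < k then 1 else 2) = 4 by
    rw [memC] at hp; rw [if_neg (by omega), if_neg (by omega)]
  rw [sA, sB, sC, Finset.sum_const, Finset.sum_const, Finset.sum_const, cA, cB, cC]
  simp only [smul_eq_mul]
  ring

theorem sigmaTwoAttains_diam_two {n m k : ℕ} (hm : (n : ℤ) - 1 ≤ m)
    (hk : nuNum n k ≤ m) (hk' : (m : ℤ) < nuNum n (k + 1)) :
    SigmaTwoAttains n m 2 (diamTwoBound n m k) := by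
  have e1 := nuNum_two_mul n k
  have e2 := nuNum_two_mul n (k + 1)
  have hk1 : (nuNum n k : ℚ) ≤ m := by exact_mod_cast hk
  have hk2 : (m : ℚ) < nuNum n (k + 1) := by exact_mod_cast hk'
  push_cast at e2
  have hlt : (m : ℚ) - nuNum n k < n - k - 1 := by nlinarith
  have hlt' : (m : ℤ) - nuNum n k < n - k - 1 := by exact_mod_cast hlt
  have hk0 : 1 ≤ k := by
    rcases k with _ | k
    · have : nuNum n (0 + 1) = n - 1 := by simp [nuNum]
      omega
    · omega
  obtain ⟨e, he⟩ : ∃ e : ℕ, (m : ℤ) = nuNum n k + e := ⟨(m - nuNum n k).toNat, by omega⟩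
  have hkn : k + e + 2 ≤ n := by omega
  obtain ⟨G, hG, hs⟩ := exists_diam_two hk0 hkn
  have hme : k.choose 2 + k * (n - k) + e = m := by
    have : ((k.choose 2 + k * (n - k) + e : ℕ) : ℤ) = m := by
      rw [he, nuNum]; push_cast [Nat.cast_sub (show k ≤ n by omega)]; ring
    exact_mod_cast this
  rw [hme] at hG
  refine ⟨G, hG, le_antisymm ?_ (hG.diamTwoBound_le hk hk')⟩
  have hs : (sigmaTwo G : ℚ) ≤ ((k.choose 2 + 2 * (k * (n - k)) + 4 * e : ℕ) : ℚ) := by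
    exact_mod_cast hs
  refine hs.trans (le_of_eq ?_)
  have he' : (m : ℚ) = nuNum n k + e := by exact_mod_cast he
  rw [diamTwoBound, he']
  push_cast [Nat.cast_sub (show k ≤ n by omega)]
  ring

/-! ### Extremal graphs of diameter at least three -/

/-- The intended eccentricities in a graph with the path `0, …, d` and further vertices
`d + 1, d + 2, …`, the first `z` of which have eccentricity `r` and the others `r + 1`. -/
def eccBound (d r z i : ℕ) : ℕ :=
  if i < d + 1 then max i (d - i) else if i < d + 1 + z then r else r + 1

/-- To the path `0, …, d` with middle vertex `r` attach `w` vertices: the first `z` are joined to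
`r - 1`, the first `q` to `r + 1`, all but the first `s` to `r`, and `Q` is a set of edges between
them. In the case `s = 1` the first attached vertex and `r` are opposite vertices of a
four-cycle. The edges in `Q` cost at most `c` each. -/
theorem exists_path_with_attached {d r w q s z c : ℕ} {Q : Finset (ℕ × ℕ)} (hd : 3 ≤ d)
    (hr1 : d ≤ 2 * r) (hr2 : 2 * r ≤ d + 1) (hz : z ≤ w) (hq : q ≤ z) (hqz : 2 * r = d → q = z)
    (hs : s = 0 ∨ s = 1 ∧ z = 1 ∧ 2 * r = d ∧ (3 ≤ r ∨ w = 1))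
    (hQ : Q ⊆ increasingPairs (Finset.Ico (d + 1) (d + 1 + w)))
    (hc : ∀ p ∈ Q, eccBound d r z p.1 * eccBound d r z p.2 ≤ c) :
    ∃ G : SimpleGraph (Fin (d + 1 + w)),
      IsConnectedWith G (d + 1 + w) (d + z + q + (w - s) + Q.card) d ∧
      sigmaTwo G ≤ pathSum d + z * ((d + 1 - r) * r) + q * ((r + 1) * r) +
        r * ((z - s) * r + (w - z) * (r + 1)) + Q.card * c := by
  have hsz : s ≤ z := by omega
  have hr : 2 ≤ r := by omega
  set P := (Finset.range d).image fun i => (i, i + 1) with hP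
  set A := ({r - 1} : Finset ℕ) ×ˢ Finset.Ico (d + 1) (d + 1 + z) with hA
  set B := ({r + 1} : Finset ℕ) ×ˢ Finset.Ico (d + 1) (d + 1 + q) with hB
  set C := ({r} : Finset ℕ) ×ˢ Finset.Ico (d + 1 + s) (d + 1 + w) with hC
  have memP : ∀ p, p ∈ P ↔ p.1 < d ∧ p.2 = p.1 + 1 := fun p => by
    rw [hP, Finset.mem_image]
    constructor
    · rintro ⟨i, hi, rfl⟩
      exact ⟨Finset.mem_range.1 hi, rfl⟩
    · rintro ⟨h1, h2⟩
      exact ⟨p.1, Finset.mem_range.2 h1, Prod.ext rfl h2.symm⟩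
  have memA : ∀ p, p ∈ A ↔ p.1 = r - 1 ∧ d + 1 ≤ p.2 ∧ p.2 < d + 1 + z := fun p => by
    rw [hA, Finset.mem_product, Finset.mem_singleton, Finset.mem_Ico]
  have memB : ∀ p, p ∈ B ↔ p.1 = r + 1 ∧ d + 1 ≤ p.2 ∧ p.2 < d + 1 + q := fun p => by
    rw [hB, Finset.mem_product, Finset.mem_singleton, Finset.mem_Ico]
  have memC : ∀ p, p ∈ C ↔ p.1 = r ∧ d + 1 + s ≤ p.2 ∧ p.2 < d + 1 + w := fun p => by
    rw [hC, Finset.mem_product, Finset.mem_singleton, Finset.mem_Ico]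
  have hQ' : ∀ p ∈ Q, d + 1 ≤ p.1 ∧ p.1 < p.2 ∧ p.2 < d + 1 + w := fun p hp => by
    have := mem_increasingPairs.1 (hQ hp)
    rw [Finset.mem_Ico, Finset.mem_Ico] at this
    omega
  have d1 : Disjoint P A := Finset.disjoint_left.2 fun p hp hp' => by
    rw [memP] at hp; rw [memA] at hp'; omega
  have d2 : Disjoint (P ∪ A) B := Finset.disjoint_left.2 fun p hp hp' => by
    rw [Finset.mem_union, memP, memA] at hp; rw [memB] at hp'; omega
  have d3 : Disjoint (P ∪ A ∪ B) C := Finset.disjoint_left.2 fun p hp hp' => by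
    rw [Finset.mem_union, Finset.mem_union, memP, memA, memB] at hp; rw [memC] at hp'; omega
  have d4 : Disjoint (P ∪ A ∪ B ∪ C) Q := Finset.disjoint_left.2 fun p hp hp' => by
    rw [Finset.mem_union, Finset.mem_union, Finset.mem_union, memP, memA, memB, memC] at hp
    have := hQ' p hp'
    omega
  set E := P ∪ A ∪ B ∪ C ∪ Q with hEdef
  have mem : ∀ p, p ∈ E ↔ (((p ∈ P ∨ p ∈ A) ∨ p ∈ B) ∨ p ∈ C) ∨ p ∈ Q := fun p => by
    simp only [hEdef, Finset.mem_union]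
  have hE : ∀ p ∈ E, p.1 < p.2 ∧ p.2 < d + 1 + w := fun p hp => by
    rw [mem, memP, memA, memB, memC] at hp
    rcases hp with hp | hp
    · omega
    · have := hQ' p hp
      omega
  have adj : ∀ {i j}, (i, j) ∈ E → Within (pairGraph (d + 1 + w) E) 1 i j := within_one hE
  have wP : ∀ i j, i ≤ j → j ≤ d → Within (pairGraph (d + 1 + w) E) (j - i) i j := by
    intro i j hij
    induction j, hij using Nat.le_induction with
    | base => exact fun h => Within.refl (by omega)
    | succ j hij ih =>
      intro hj
      exact ((ih (by omega)).trans (adj ((mem _).2 (Or.inl (Or.inl (Or.inl (Or.inl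
        ((memP (j, j + 1)).2 ⟨hj, rfl⟩)))))))).mono (by omega)
  have wA : ∀ j, d + 1 ≤ j → j < d + 1 + z → Within (pairGraph (d + 1 + w) E) 1 (r - 1) j :=
    fun j h1 h2 => adj ((mem _).2 (Or.inl (Or.inl (Or.inl (Or.inr ((memA (r - 1, j)).2
      ⟨rfl, h1, h2⟩))))))
  have wB : ∀ j, d + 1 ≤ j → j < d + 1 + q → Within (pairGraph (d + 1 + w) E) 1 (r + 1) j :=
    fun j h1 h2 => adj ((mem _).2 (Or.inl (Or.inl (Or.inr ((memB (r + 1, j)).2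
      ⟨rfl, h1, h2⟩)))))
  have wC : ∀ j, d + 1 + s ≤ j → j < d + 1 + w → Within (pairGraph (d + 1 + w) E) 1 r j :=
    fun j h1 h2 => adj ((mem _).2 (Or.inl (Or.inr ((memC (r, j)).2 ⟨rfl, h1, h2⟩))))
  -- distances between the path and the attached vertices
  have wPW : ∀ i j, i ≤ d → d + 1 ≤ j → j < d + 1 + w → ∃ k, k ≤ eccBound d r z i ∧
      k ≤ eccBound d r z j ∧ Within (pairGraph (d + 1 + w) E) k i j := by
    intro i j hi hj1 hj2
    rw [eccBound, if_pos (by omega), eccBound, if_neg (by omega)]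
    by_cases hjz : j < d + 1 + z
    · rw [if_pos hjz]
      rcases lt_or_ge i r with hir | hir
      · exact ⟨r - i, by omega, by omega,
          ((wP i (r - 1) (by omega) (by omega)).trans (wA j hj1 hjz)).mono (by omega)⟩
      by_cases hrd : 2 * r = d
      · rcases hir.lt_or_eq with hir | rfl
        · exact ⟨i - r, by omega, by omega,
            ((wP (r + 1) i (by omega) (by omega)).symm.trans
              (wB j hj1 (by rw [hqz hrd]; exact hjz))).mono (by omega)⟩
        · exact ⟨2, by omega, by omega, ((wP (r - 1) r (by omega) (by omega)).symm.trans
            (wA j hj1 hjz)).mono (by omega)⟩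
      · exact ⟨i - r + 1, by omega, by omega,
          (wP r i (by omega) (by omega)).symm.trans (wC j (by omega) hj2)⟩
    · rw [if_neg hjz]
      rcases lt_or_ge i r with hir | hir
      · exact ⟨r - i + 1, by omega, by omega,
          (wP i r (by omega) (by omega)).trans (wC j (by omega) hj2)⟩
      · exact ⟨i - r + 1, by omega, by omega,
          (wP r i (by omega) (by omega)).symm.trans (wC j (by omega) hj2)⟩
  -- distances between attached vertices
  have wW : ∀ i j, d + 1 ≤ i → i < d + 1 + w → d + 1 ≤ j → j < d + 1 + w →
      Within (pairGraph (d + 1 + w) E) r i j := by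
    intro i j hi1 hi2 hj1 hj2
    have key : ∀ j, d + 1 + s ≤ j → j < d + 1 + w → s ≠ 0 →
        Within (pairGraph (d + 1 + w) E) r (d + 1) j := fun j hj1 hj2 h => by
      exact ((wA (d + 1) le_rfl (by omega)).symm.trans ((wP (r - 1) r (by omega) (by omega)).trans
        (wC j hj1 hj2))).mono (by omega)
    by_cases hi : d + 1 + s ≤ i <;> by_cases hj : d + 1 + s ≤ j
    · exact ((wC i hi hi2).symm.trans (wC j hj hj2)).mono (by omega)
    · rw [show j = d + 1 by omega]
      exact (key i hi hi2 (by omega)).symm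
    · rw [show i = d + 1 by omega]
      exact key j hj hj2 (by omega)
    · rw [show i = j by omega]
      exact Within.refl hj2
  have key := pairGraph_isConnectedWith hE (d := d) (H := eccBound d r z)
    (φ := fun i => if i ≤ d then i else r)
    (fun i _ => by rw [eccBound]; split_ifs <;> omega)
    (fun i hi j hj => by
      by_cases hid : i ≤ d <;> by_cases hjd : j ≤ d
      · rw [eccBound, if_pos (by omega)]
        rcases le_total i j with hij | hij
        · exact (wP i j hij hjd).mono (by omega)
        · exact (wP j i hij hid).symm.mono (by omega)
      · obtain ⟨k, hk, -, h⟩ := wPW i j hid (by omega) hj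
        exact h.mono hk
      · obtain ⟨k, -, hk, h⟩ := wPW j i hjd (by omega) hi
        exact h.symm.mono hk
      · refine (wW i j (by omega) hi (by omega) hj).mono ?_
        rw [eccBound, if_neg (by omega)]
        split_ifs <;> omega)
    (fun p hp => by
      rw [mem, memP, memA, memB, memC] at hp
      rcases hp with hp | hp
      · split_ifs <;> omega
      · have := hQ' p hp
        split_ifs <;> omega)
    (x := 0) (y := d) (by omega) (by omega) (by simp)
  have cP : P.card = d := by
    rw [hP, Finset.card_image_of_injective _ fun i j h => (Prod.ext_iff.1 h).1, Finset.card_range]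
  have cA : A.card = z := by
    rw [hA, Finset.card_product, Finset.card_singleton, Nat.card_Ico]; omega
  have cB : B.card = q := by
    rw [hB, Finset.card_product, Finset.card_singleton, Nat.card_Ico]; omega
  have cC : C.card = w - s := by
    rw [hC, Finset.card_product, Finset.card_singleton, Nat.card_Ico]; omega
  have cE : E.card = d + z + q + (w - s) + Q.card := by
    rw [hEdef, Finset.card_union_of_disjoint d4, Finset.card_union_of_disjoint d3,
      Finset.card_union_of_disjoint d2, Finset.card_union_of_disjoint d1, cP, cA, cB, cC]
  have sP : ∑ p ∈ P, eccBound d r z p.1 * eccBound d r z p.2 = pathSum d := by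
    rw [hP, Finset.sum_image fun i _ j _ h => (Prod.ext_iff.1 h).1, pathSum]
    refine Finset.sum_congr rfl fun i hi => ?_
    have := Finset.mem_range.1 hi
    rw [eccBound, eccBound, if_pos (by omega), if_pos (by omega)]
  have sA : ∑ p ∈ A, eccBound d r z p.1 * eccBound d r z p.2 = z * ((d + 1 - r) * r) := by
    rw [Finset.sum_congr rfl fun p hp => show _ = (d + 1 - r) * r from ?_, Finset.sum_const, cA,
      smul_eq_mul]
    rw [memA] at hp
    rw [eccBound, eccBound, if_pos (by omega), if_neg (by omega), if_pos (by omega)]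
    congr 1
    omega
  have sB : ∑ p ∈ B, eccBound d r z p.1 * eccBound d r z p.2 = q * ((r + 1) * r) := by
    rw [Finset.sum_congr rfl fun p hp => show _ = (r + 1) * r from ?_, Finset.sum_const, cB,
      smul_eq_mul]
    rw [memB] at hp
    rw [eccBound, eccBound, if_pos (by omega), if_neg (by omega), if_pos (by omega)]
    congr 1
    omega
  have sC : ∑ p ∈ C, eccBound d r z p.1 * eccBound d r z p.2 =
      r * ((z - s) * r + (w - z) * (r + 1)) := by
    rw [hC, Finset.sum_product, Finset.sum_singleton]
    dsimp only
    rw [← Finset.mul_sum]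
    congr 1
    · rw [eccBound, if_pos (by omega)]
      omega
    · rw [← Finset.sum_Ico_consecutive _ (show d + 1 + s ≤ d + 1 + z by omega)
        (show d + 1 + z ≤ d + 1 + w by omega)]
      congr 1
      · rw [Finset.sum_congr rfl fun j hj => show eccBound d r z j = r from ?_, Finset.sum_const,
          Nat.card_Ico, smul_eq_mul, show d + 1 + z - (d + 1 + s) = z - s by omega]
        have := Finset.mem_Ico.1 hj
        rw [eccBound, if_neg (by omega), if_pos (by omega)]
      · rw [Finset.sum_congr rfl fun j hj => show eccBound d r z j = r + 1 from ?_,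
          Finset.sum_const, Nat.card_Ico, smul_eq_mul,
          show d + 1 + w - (d + 1 + z) = w - z by omega]
        have := Finset.mem_Ico.1 hj
        rw [eccBound, if_neg (by omega), if_neg (by omega)]
  refine ⟨_, cE ▸ key.1, key.2.trans ?_⟩
  rw [hEdef, Finset.sum_union d4, Finset.sum_union d3, Finset.sum_union d2, Finset.sum_union d1,
    sP, sA, sB, sC, ← smul_eq_mul (Q.card)]
  exact add_le_add le_rfl (Finset.sum_le_card_nsmul _ _ _ hc)

theorem sigmaTwoAttains_of_le {n m d X : ℕ} {q : ℚ}
    (h : ∃ G : SimpleGraph (Fin n), IsConnectedWith G n m d ∧ sigmaTwo G ≤ X) (hX : (X : ℚ) = q)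
    (hq : ∀ G : SimpleGraph (Fin n), IsConnectedWith G n m d → q ≤ sigmaTwo G) :
    SigmaTwoAttains n m d q := by
  obtain ⟨G, hG, hs⟩ := h
  exact ⟨G, hG, le_antisymm (hX ▸ by exact_mod_cast hs) (hq G hG)⟩

/-- In all cases every attached vertex is joined to `r`. In the middle range all are joined to
`r - 1` too, with further edges between them. Below it `k` of them have degree one; above it all
possible edges between them are present, and `k` of them are joined to `r + 1`. -/
theorem sigmaTwoAttains_odd {n m d k : ℕ} (hd : Odd d) (hd3 : 3 ≤ d) (hdn : d + 1 ≤ n)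
    (hk : (k = 0 ∧ (2 * n - 2 - d : ℤ) ≤ m ∧ (m : ℤ) ≤ ((n - d).choose 2 : ℤ) + n - 1) ∨
      ((k : ℤ) ≤ n - d - 1 ∧
        ((m : ℤ) = 2 * n - 2 - d - k ∨ (m : ℤ) = ((n - d).choose 2 : ℤ) + n - 1 + k))) :
    SigmaTwoAttains n m d (oddBound m d + k * (((d : ℚ) + 1) / 2)) := by
  have hlow : ∀ G : SimpleGraph (Fin n), IsConnectedWith G n m d →
      oddBound m d + k * (((d : ℚ) + 1) / 2) ≤ sigmaTwo G := fun G hG =>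
    hG.oddBound_le hd (by tauto)
  obtain ⟨t, rfl⟩ := hd
  obtain ⟨w, rfl⟩ := Nat.exists_eq_add_of_le hdn
  have hcw := choose_succ_two w
  rw [show w + 1 = 2 * t + 1 + 1 + w - (2 * t + 1) by omega] at hcw
  rw [oddBound_eq] at hlow ⊢
  set I := Finset.Ico (2 * t + 1 + 1) (2 * t + 1 + 1 + w) with hI
  have hIc : (increasingPairs I).card = w.choose 2 := by
    rw [card_increasingPairs, Nat.card_Ico]; congr 1; omega
  have hc : ∀ p ∈ increasingPairs I, eccBound (2 * t + 1) (t + 1) w p.1 *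
      eccBound (2 * t + 1) (t + 1) w p.2 ≤ (t + 1) * (t + 1) := fun p hp => by
    obtain ⟨h1, h2, -⟩ := mem_increasingPairs.1 hp
    have h1 := Finset.mem_Ico.1 h1
    have h2 := Finset.mem_Ico.1 h2
    rw [eccBound, eccBound, if_neg (by omega), if_pos (by omega), if_neg (by omega),
      if_pos (by omega)]
  have ht : 2 * t + 1 + 1 - (t + 1) = t + 1 := by omega
  rcases hk with ⟨rfl, hk1, hk2⟩ | ⟨hkw, hk | hk⟩
  · obtain ⟨e, rfl⟩ : ∃ e, m = 2 * t + 1 + w + 0 + (w - 0) + e :=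
      ⟨m - (2 * t + 1 + w + 0 + (w - 0)), by omega⟩
    obtain ⟨Q, hQ, rfl⟩ := Finset.exists_subset_card_eq
      (show e ≤ (increasingPairs I).card by rw [hIc]; omega)
    refine sigmaTwoAttains_of_le (exists_path_with_attached (r := t + 1) (s := 0) hd3 (by omega)
      (by omega) le_rfl (Nat.zero_le _) (by omega) (Or.inl rfl) hQ fun p hp => hc p (hQ hp)) ?_ hlow
    rw [ht, Nat.sub_zero, Nat.sub_self]
    push_cast
    ring
  · obtain ⟨z, rfl⟩ : ∃ z, w = z + k := ⟨w - k, by omega⟩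
    obtain rfl : m = 2 * t + 1 + z + 0 + (z + k - 0) + (∅ : Finset (ℕ × ℕ)).card := by
      rw [Finset.card_empty]; omega
    refine sigmaTwoAttains_of_le (exists_path_with_attached (r := t + 1) (s := 0) (c := 0) hd3
      (by omega) (by omega) (by omega) (Nat.zero_le _) (by omega) (Or.inl rfl)
      (Finset.empty_subset _) fun p hp => absurd hp (Finset.notMem_empty p)) ?_ hlow
    simp only [ht, Nat.sub_zero, Nat.add_sub_cancel_left, Finset.card_empty]
    push_cast
    ring
  · obtain rfl : m = 2 * t + 1 + w + k + (w - 0) + (increasingPairs I).card := by omega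
    refine sigmaTwoAttains_of_le (exists_path_with_attached (r := t + 1) (s := 0) hd3 (by omega)
      (by omega) le_rfl (by omega) (by omega) (Or.inl rfl) le_rfl hc) ?_ hlow
    rw [ht, Nat.sub_zero, Nat.sub_self]
    push_cast
    ring

/-- With `m = n - 1 + k + e`, the range of `m` is `C(k, 2) ≤ e ≤ C(k + 1, 2)`. If `k ≤ e`, then `k`
attached vertices have eccentricity `r`, and `e` edges join them to `r` and to each other. The
remaining cases are `k = 1`, `e = 0` and `k = 2`, `e = 1`. -/
theorem sigmaTwoAttains_even {n m d k : ℕ} (hd : Even d) (hd4 : 4 ≤ d) (hdn : d + 1 ≤ n)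
    (hm : (m : ℤ) ≤ ((n - d).choose 2 : ℤ) + (2 * n - d - 2))
    (hk : muNum n ((k : ℤ) - 1) < m) (hk' : (m : ℤ) ≤ muNum n k)
    (hexc : ¬ (d = 4 ∧ m = n ∧ 7 ≤ n)) : SigmaTwoAttains n m d (evenBound n m d k) := by
  have hlow : ∀ G : SimpleGraph (Fin n), IsConnectedWith G n m d →
      evenBound n m d k ≤ sigmaTwo G := fun G hG => hG.evenBound_le hd hk
  obtain ⟨r, rfl⟩ := hd
  rw [← two_mul] at *
  obtain ⟨w, rfl⟩ := Nat.exists_eq_add_of_le hdn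
  have hcw := choose_succ_two w
  rw [show w + 1 = 2 * r + 1 + w - 2 * r by omega] at hcw
  rw [evenBound_eq] at hlow ⊢
  have hr : 2 * r + 1 - r = r + 1 := by omega
  rw [muNum_natCast] at hk'
  rcases k with _ | j
  · rw [muNum_zero_sub_one] at hk
    simp only [Nat.choose_zero_succ] at hk'
    obtain rfl : m = 2 * r + 0 + 0 + (w - 0) + (∅ : Finset (ℕ × ℕ)).card := by
      rw [Finset.card_empty]; omega
    refine sigmaTwoAttains_of_le (exists_path_with_attached (r := r) (s := 0) (c := 0) (by omega)
      (by omega) (by omega) (Nat.zero_le _) le_rfl (by omega) (Or.inl rfl)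
      (Finset.empty_subset _) fun p hp => absurd hp (Finset.notMem_empty p)) ?_ hlow
    rw [Nat.sub_zero, Nat.sub_zero, Finset.card_empty]
    push_cast
    ring
  rw [muNum_succ_sub_one] at hk
  have hcj := choose_succ_two j
  have hjw : j + 1 ≤ w := by
    by_contra hlt
    have := Nat.choose_le_choose 2 (show w ≤ j by omega)
    omega
  obtain ⟨e, rfl⟩ : ∃ e, m = 2 * r + w + (j + 1) + e := ⟨m - (2 * r + w + (j + 1)), by omega⟩
  obtain ⟨u, rfl⟩ := Nat.exists_eq_add_of_le hjw
  by_cases he : j + 1 ≤ e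
  · -- the first `j + 1` attached vertices are joined to `r - 1`, `r` and `r + 1`
    obtain ⟨f, rfl⟩ := Nat.exists_eq_add_of_le he
    set J := Finset.Ico (2 * r + 1) (2 * r + 1 + (j + 1)) with hJ
    obtain ⟨Q, hQ, rfl⟩ := Finset.exists_subset_card_eq
      (show f ≤ (increasingPairs J).card by
        rw [card_increasingPairs, Nat.card_Ico, Nat.add_sub_cancel_left]; omega)
    have hQ' : ∀ p ∈ Q, 2 * r + 1 ≤ p.1 ∧ p.1 < 2 * r + 1 + (j + 1) ∧ 2 * r + 1 ≤ p.2 ∧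
        p.2 < 2 * r + 1 + (j + 1) ∧ p.1 < p.2 := fun p hp => by
      have := mem_increasingPairs.1 (hQ hp)
      rw [Finset.mem_Ico, Finset.mem_Ico] at this
      omega
    rw [show 2 * r + (j + 1 + u) + (j + 1) + (j + 1 + Q.card) =
      2 * r + (j + 1) + (j + 1) + (j + 1 + u - 0) + Q.card by omega] at hlow ⊢
    refine sigmaTwoAttains_of_le (exists_path_with_attached (r := r) (s := 0) (c := r * r)
      (by omega) (by omega) (by omega) (by omega) le_rfl (fun _ => rfl) (Or.inl rfl)
      (fun p hp => mem_increasingPairs.2 ?_) fun p hp => ?_) ?_ hlow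
    · have := hQ' p hp
      rw [Finset.mem_Ico, Finset.mem_Ico]
      omega
    · have := hQ' p hp
      rw [eccBound, eccBound, if_neg (by omega), if_pos (by omega), if_neg (by omega),
        if_pos (by omega)]
    · rw [hr, Nat.sub_zero, Nat.sub_zero, Nat.add_sub_cancel_left]
      push_cast
      ring
  rcases j with _ | _ | j
  · -- a four-cycle through `r - 1` and `r + 1` with `r` opposite to an attached vertex
    simp only [Nat.choose_zero_succ] at hk hk' hcj
    obtain rfl : e = 0 := by omega
    rw [show 2 * r + (0 + 1 + u) + (0 + 1) + 0 =
      2 * r + 1 + 1 + (1 + u - 1) + (∅ : Finset (ℕ × ℕ)).card by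
        rw [Finset.card_empty]; omega] at hlow hexc ⊢
    rw [show 2 * r + 1 + (0 + 1 + u) = 2 * r + 1 + (1 + u) by omega] at hlow hexc ⊢
    rw [Finset.card_empty] at hexc
    refine sigmaTwoAttains_of_le (exists_path_with_attached (r := r) (s := 1) (c := 0) (by omega)
      (by omega) (by omega) (by omega) le_rfl (fun _ => rfl)
      (Or.inr ⟨rfl, rfl, rfl, by omega⟩)
      (Finset.empty_subset _) fun p hp => absurd hp (Finset.notMem_empty p)) ?_ hlow
    rw [hr, Nat.sub_self, Nat.add_sub_cancel_left, Finset.card_empty]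
    push_cast
    ring
  · -- the first attached vertex is joined to a second one, of eccentricity `r + 1`
    rw [show Nat.choose (0 + 1) 2 = 0 from rfl] at hk
    rw [show Nat.choose (0 + 1 + 1) 2 = 1 from rfl] at hk'
    obtain rfl : e = 1 := by omega
    rw [show 2 * r + (0 + 1 + 1 + u) + (0 + 1 + 1) + 1 =
      2 * r + 1 + 1 + (2 + u - 0) + ({(2 * r + 1, 2 * r + 2)} : Finset (ℕ × ℕ)).card by
        rw [Finset.card_singleton]; omega] at hlow ⊢
    rw [show 2 * r + 1 + (0 + 1 + 1 + u) = 2 * r + 1 + (2 + u) by omega] at hlow ⊢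
    refine sigmaTwoAttains_of_le (exists_path_with_attached (r := r) (s := 0)
      (c := r * (r + 1)) (by omega) (by omega) (by omega) (by omega) le_rfl (fun _ => rfl)
      (Or.inl rfl) (Finset.singleton_subset_iff.2 (mem_increasingPairs.2 ?_)) fun p hp => ?_)
      ?_ hlow
    · simp only [Finset.mem_Ico]
      omega
    · rw [Finset.mem_singleton.1 hp, eccBound, eccBound, if_neg (by omega), if_pos (by omega),
        if_neg (by omega), if_neg (by omega)]
    · rw [hr, Nat.sub_zero, Nat.sub_zero, show 2 + u - 1 = u + 1 by omega, Finset.card_singleton]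
      push_cast
      ring
  · exfalso
    have h1 := choose_succ_two (j + 1)
    have h2 := choose_succ_two j
    omega

/-- Equality holds for a path of length four with `n - 5` vertices attached to its middle vertex,
two of which are adjacent. -/
theorem sigmaTwoAttains_unicyclic {n : ℕ} (hn : 7 ≤ n) :
    SigmaTwoAttains n n 4 (6 * n + 15) := by
  obtain ⟨u, rfl⟩ := Nat.exists_eq_add_of_le hn
  have hlow : ∀ G : SimpleGraph (Fin (7 + u)), IsConnectedWith G (7 + u) (7 + u) 4 →
      6 * ((7 + u : ℕ) : ℚ) + 15 ≤ sigmaTwo G := fun G hG => hG.unicyclic_le hn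
  have key := exists_path_with_attached (d := 4) (r := 2) (s := 0) (q := 0) (z := 0) (w := 2 + u)
    (c := 9) (Q := {(5, 6)}) (by omega) (by omega) (by omega) (by omega) le_rfl (fun _ => rfl)
    (Or.inl rfl) (Finset.singleton_subset_iff.2 (mem_increasingPairs.2 (by
      simp only [Finset.mem_Ico]; omega))) fun p hp => by
        rw [Finset.mem_singleton.1 hp]; rfl
  rw [Finset.card_singleton, show 4 + 1 + (2 + u) = 7 + u by omega,
    show 4 + 0 + 0 + (2 + u - 0) + 1 = 7 + u by omega] at key
  refine sigmaTwoAttains_of_le key ?_ hlow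
  rw [show pathSum 4 = 36 by decide]
  simp only [Nat.sub_zero]
  push_cast
  ring

theorem theorem3p2 (n m d : ℕ) :
    -- Lower bounds
    (∀ (V : Type*) [Fintype V] (G : SimpleGraph V), IsConnectedWith G n m d →
      -- the range of the number of edges
      ((n : ℤ) - 1 ≤ m ∧ (m : ℤ) ≤ ((n - d).choose 2 : ℤ) + (2 * n - d - 2)) ∧
      -- odd diameter, middle range
      (Odd d → (2 * n - 2 - d : ℤ) ≤ m → (m : ℤ) ≤ ((n - d).choose 2 : ℤ) + n - 1 →
        oddBound m d ≤ sigmaTwo G) ∧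
      -- odd diameter, below and above the middle range
      (Odd d → ∀ k : ℕ, 1 ≤ k → (k : ℤ) ≤ n - d - 1 →
        ((m : ℤ) = 2 * n - 2 - d - k ∨ (m : ℤ) = ((n - d).choose 2 : ℤ) + n - 1 + k) →
        oddBound m d + k * (((d : ℚ) + 1) / 2) ≤ sigmaTwo G) ∧
      -- even diameter at least four
      (Even d → 4 ≤ d → ∀ k : ℕ, muNum n ((k : ℤ) - 1) < m → (m : ℤ) ≤ muNum n k →
        evenBound n m d k ≤ sigmaTwo G ∧
        (d = 4 → m = n → 7 ≤ n → evenBound n m d k + 3 ≤ sigmaTwo G)) ∧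
      -- diameter two
      (d = 2 → ∀ k : ℕ, nuNum n k ≤ m → (m : ℤ) < nuNum n (k + 1) →
        diamTwoBound n m k ≤ sigmaTwo G)) ∧
    -- Sharpness, for all parameters in the stated range of the number of edges
    -- (for diameter one, where the only graph is the complete graph, for `m = C(n,2)`)
    (d + 1 ≤ n → (n : ℤ) - 1 ≤ m → (m : ℤ) ≤ ((n - d).choose 2 : ℤ) + (2 * n - d - 2) →
      (2 ≤ d ∨ (d = 1 ∧ m = n.choose 2)) →
      (Odd d → (2 * n - 2 - d : ℤ) ≤ m → (m : ℤ) ≤ ((n - d).choose 2 : ℤ) + n - 1 →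
        SigmaTwoAttains n m d (oddBound m d)) ∧
      (Odd d → ∀ k : ℕ, 1 ≤ k → (k : ℤ) ≤ n - d - 1 →
        ((m : ℤ) = 2 * n - 2 - d - k ∨ (m : ℤ) = ((n - d).choose 2 : ℤ) + n - 1 + k) →
        SigmaTwoAttains n m d (oddBound m d + k * (((d : ℚ) + 1) / 2))) ∧
      (Even d → 4 ≤ d → ∀ k : ℕ, muNum n ((k : ℤ) - 1) < m → (m : ℤ) ≤ muNum n k →
        (¬ (d = 4 ∧ m = n ∧ 7 ≤ n) → SigmaTwoAttains n m d (evenBound n m d k)) ∧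
        (d = 4 ∧ m = n ∧ 7 ≤ n → SigmaTwoAttains n m d (evenBound n m d k + 3))) ∧
      (d = 2 → ∀ k : ℕ, nuNum n k ≤ m → (m : ℤ) < nuNum n (k + 1) →
        SigmaTwoAttains n m d (diamTwoBound n m k))) := by

  refine ⟨fun V _ G hG => ⟨hG.edges_range, fun hd h1 h2 => ?_, fun hd k _ _ hk =>
      hG.oddBound_le hd (Or.inr hk), fun hd _ k hk hk' => ⟨hG.evenBound_le hd hk, ?_⟩, ?_⟩,
    fun hdn hm1 hm2 hd => ⟨fun ho h1 h2 => ?_, fun ho k hk1 hkn hk => ?_,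
      fun he hd4 k hk hk' => ⟨sigmaTwoAttains_even he hd4 hdn hm2 hk hk', ?_⟩, ?_⟩⟩
  · simpa using hG.oddBound_le hd (k := 0) (Or.inl rfl)
  · rintro rfl rfl hn
    rw [(evenBound_unicyclic hk hk').2]
    exact hG.unicyclic_le hn
  · rintro rfl k hk hk'
    exact hG.diamTwoBound_le hk hk'
  · rcases hd with hd | ⟨rfl, rfl⟩
    · obtain ⟨t, rfl⟩ := ho
      simpa using sigmaTwoAttains_odd (k := 0) ⟨t, rfl⟩ (by omega) hdn (Or.inl ⟨rfl, h1, h2⟩)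
    · exact sigmaTwoAttains_complete hdn
  · have hd3 : 3 ≤ d := by
      rcases hd with hd | ⟨rfl, rfl⟩
      · obtain ⟨t, rfl⟩ := ho
        omega
      -- the number of edges of a complete graph is in the middle range
      exfalso
      obtain ⟨u, rfl⟩ := Nat.exists_eq_add_of_le' hdn
      have h1 := choose_succ_two (u + 1)
      have h2 := choose_succ_two u
      rw [show u + (1 + 1) - 1 = u + 1 by omega, show u + (1 + 1) = u + 1 + 1 by omega] at hk
      omega
    exact sigmaTwoAttains_odd ho hd3 hdn (Or.inr ⟨hkn, hk⟩)
  · rintro ⟨rfl, rfl, hn⟩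
    rw [(evenBound_unicyclic hk hk').2]
    exact sigmaTwoAttains_unicyclic hn
  · rintro rfl k hk hk'
    exact sigmaTwoAttains_diam_two hm1 hk hk'
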